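/- **Setting.** Let $n\ge 1$, $0\le k\le n$, $\beta=(\beta_1,\dots,\beta_k)\in(0,1]^k$, $\epsilon\in[0,1]$, and let $D=\{z_1\cdots z_k=0\}\subset\mathbb C^n$ ($D=\emptyset$ if $k=0$). Let $$g_{\beta,\epsilon}=\sum_{j\le k}\frac{\beta_j^2}{(|z_j|^2+\epsilon^2)^{1-\beta_j}}\,dz_j\otimes d\bar z_j+\sum_{j>k}dz_j\otimes d\bar z_j ,$$ a metric on $\mathbb C^n\setminus D$. Its polar coordinates are $\xi_j=s_j(|z_j|)\,e^{\sqrt{-1}\theta_j}$ for $j\le k$, where $z_j=|z_j|e^{\sqrt{-1}\theta_j}$ and $s_j'(\rho)=\beta_j(\rho^2+\epsilon^2)^{-(1-\beta_j)/2}$, $s_j(0)=0$ (so $s_j(\rho)=\rho^{\beta_j}$ if $\epsilon=0$), and $\xi_j=z_j$ for $j>k$. For $y_0,y_1\in\mathbb C^n$, $r>0$, $T_0<T_1$ let $y(t)=y_0+\frac{t-T_0}{T_1-T_0}(y_1-y_0)$ and let $SC_r=\{(\xi,t):|\xi-y(t)|<r,\ T_0<t\le T_1\}$ be the slant cylinder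 (in the polar coordinates $\xi$), with parabolic slope $l=\frac{r(y_1-y_0)}{T_1-T_0}$. Let $Q$ be the set of all $(\xi,t)$ with $\xi\notin D$, $|\xi-y(t)|<r$, $T_0\le t\le T_1$. Let $g=(g_t)_{T_0\le t\le T_1}$ be a family of Kähler metrics on the time slices of $Q$, each locally Hölder continuous in space (closedness of the Kähler form being understood in the sense of distributions), differentiable in time, such that on $Q$ $$\tfrac1K\,g_{\beta,\epsilon}\le g_t\le K\,g_{\beta,\epsilon},\qquad \tfrac{\partial}{\partial t}\,dvol_{g_t}\le K\,dvol_{g_t}.$$ (For $\epsilon=0$ these are the weak-conic metrics; every $\epsilon$-nearly-conic family, $\epsilon>0$, is also of this type.) A function $u$ is a *weak subsolution* of $\partial_t u-\Delta_{g_t}u\le 0$ in $SC_r$ if, for some $\alpha\in(0,1)$, $u\in C^{2+\alpha,1+\alpha/2}$ locally on $Q$, $u$ is bounded on $SC_r\setminus D$, and the inequality holds classically on $Q$. **Theorem (Slant Cylinder Theorem).** There is $\lambda\in(0,1)$, depending only on $n$, $\beta$, $K$ and on upper bounds for $|l|$, $T_1-T_0$ and $\frac{T_1-T_0}{r^2}$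 (in particular not on $\epsilon$, $g$, $u$), such that the following holds. If $u$ is a weak subsolution in $SC_r$ as above, $u\le 0$ on the initial slice $\{(\xi,T_0):|\xi-y_0|<r,\ \xi\notin D\}$, and $y_1\notin D$, then for $Y=(y_1,T_1)$ $$u(Y)\le(1-\lambda)\,\sup_{SC_r\setminus D}u^+ .$$ -/

import Mathlib

open scoped Topology ContDiff ComplexOrder

noncomputable section

namespace Conic

/-- Complex Euclidean space `ℂⁿ`, with the norm `|x|² = ∑ |x_j|²`. -/
abbrev Space (n : ℕ) : Type := EuclideanSpace ℂ (Fin n)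

/-! ### The model metrics and their polar coordinates -/

/-- A normal crossing divisor `D = {z_1 ⋯ z_k = 0}` in `ℂⁿ` with cone angles `2π β_1, …, 2π β_k`
(the values `β j` for the other `n - k` indices are not used). -/
structure ConeData (n : ℕ) where
  k : ℕ
  k_le : k ≤ n
  β : Fin n → ℝ
  β_pos : ∀ j : Fin n, (j : ℕ) < k → 0 < β j
  β_le_one : ∀ j : Fin n, (j : ℕ) < k → β j ≤ 1

variable {n : ℕ}

/-- The divisor `D = {z_1 ⋯ z_k = 0}`. -/
def ConeData.divisor (c : ConeData n) : Set (Space n) :=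
  {z | ∃ j : Fin n, (j : ℕ) < c.k ∧ z j = 0}

/-- The matrix of the model metric
`∑_{j ≤ k} β_j² (|z_j|² + ε²)^{β_j - 1} dz_j ⊗ dz̄_j + ∑_{j > k} dz_j ⊗ dz̄_j`
in the holomorphic coordinates `z`: the model cone metric if `ε = 0`, the model of the
`ε`-nearly-conic metrics if `ε > 0`. -/
def ConeData.modelMetric (c : ConeData n) (ε : ℝ) (z : Space n) : Matrix (Fin n) (Fin n) ℂ :=
  Matrix.diagonal fun j =>
    if (j : ℕ) < c.k then
      ((c.β j ^ 2 / (‖z j‖ ^ 2 + ε ^ 2) ^ (1 - c.β j) : ℝ) : ℂ)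
    else 1

/-- The solution `s` of `ds/dρ = b (ρ² + ε²)^{-(1-b)/2}`, `s(0) = 0`. -/
def polarRadius (b ε ρ : ℝ) : ℝ :=
  ∫ x in (0 : ℝ)..ρ, b / (x ^ 2 + ε ^ 2) ^ ((1 - b) / 2)

/-- For `ε = 0` the polar radius is `ρ ^ b`. -/
theorem polarRadius_zero {b ρ : ℝ} (hb : 0 < b) (hρ : 0 ≤ ρ) : polarRadius b 0 ρ = ρ ^ b := by
  have h : polarRadius b 0 ρ = ∫ x in (0 : ℝ)..ρ, b * x ^ (b - 1) := by
    unfold polarRadius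
    refine intervalIntegral.integral_congr fun x hx => ?_
    rw [Set.uIcc_of_le hρ] at hx
    have hx0 : 0 ≤ x := hx.1
    have e : (x ^ 2 + (0 : ℝ) ^ 2) ^ ((1 - b) / 2) = x ^ (1 - b) := by
      have : x ^ 2 + (0 : ℝ) ^ 2 = x ^ (2 : ℝ) := by norm_num
      rw [this, ← Real.rpow_mul hx0]
      congr 1
      ring
    simp only [e]
    rw [div_eq_mul_inv, ← Real.rpow_neg hx0, neg_sub]
  rw [h, intervalIntegral.integral_const_mul, integral_rpow (Or.inl (by linarith))]
  simp only [sub_add_cancel, Real.zero_rpow hb.ne', sub_zero]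
  field_simp

/-- The polar coordinates `ξ` of the model metric as a function of the holomorphic coordinates `z`:
`ξ_j = s_j(|z_j|) e^{√-1 θ_j}` for `j ≤ k`, where `z_j = |z_j| e^{√-1 θ_j}`,
and `ξ_j = z_j` for `j > k`. -/
def ConeData.polar (c : ConeData n) (ε : ℝ) (z : Space n) : Space n :=
  WithLp.toLp 2 fun j =>
    if (j : ℕ) < c.k then ((polarRadius (c.β j) ε ‖z j‖ / ‖z j‖ : ℝ) : ℂ) * z j else z j

/-! ### Slant cylinders -/

/-- The parameters of a slant cylinder. The centers `y₀`, `y₁` are given in the polar coordinates. -/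
structure SlantCylinder (n : ℕ) where
  y₀ : Space n
  y₁ : Space n
  r : ℝ
  T₀ : ℝ
  T₁ : ℝ
  r_pos : 0 < r
  T_lt : T₀ < T₁

namespace SlantCylinder

/-- The center `y(t) = y₀ + (t - T₀)(y₁ - y₀)/(T₁ - T₀)` of the slice at time `t`. -/
def center (S : SlantCylinder n) (t : ℝ) : Space n :=
  S.y₀ + ((t - S.T₀) / (S.T₁ - S.T₀)) • (S.y₁ - S.y₀)

/-- The parabolic slope `l = r (y₁ - y₀) / (T₁ - T₀)`. -/
def slope (S : SlantCylinder n) : Space n :=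
  (S.r / (S.T₁ - S.T₀)) • (S.y₁ - S.y₀)

/-- The slant cylinder `{(ξ, t) : |ξ - y(t)| < r, T₀ < t ≤ T₁}`. -/
def toSet (S : SlantCylinder n) : Set (Space n × ℝ) :=
  {X | ‖X.1 - S.center X.2‖ < S.r ∧ S.T₀ < X.2 ∧ X.2 ≤ S.T₁}

/-- The slant cylinder minus `D`, described in the holomorphic coordinates `z`. -/
def domain (S : SlantCylinder n) (c : ConeData n) (ε : ℝ) : Set (Space n × ℝ) :=
  {X | X.1 ∉ c.divisor ∧ (c.polar ε X.1, X.2) ∈ S.toSet}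

/-- The slice at time `t` of the slant cylinder, minus `D`, in the holomorphic coordinates `z`. -/
def slice (S : SlantCylinder n) (c : ConeData n) (ε : ℝ) (t : ℝ) : Set (Space n) :=
  {z | z ∉ c.divisor ∧ ‖c.polar ε z - S.center t‖ < S.r}

/-- The slant cylinder minus `D`, including its initial slice, in the holomorphic
coordinates `z`. -/
def closedDomain (S : SlantCylinder n) (c : ConeData n) (ε : ℝ) : Set (Space n × ℝ) :=
  {X | X.1 ∈ S.slice c ε X.2 ∧ X.2 ∈ Set.Icc S.T₀ S.T₁}

end SlantCylinder

/-! ### Complex derivatives and Kähler metrics -/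

/-- `∂ψ/∂z_i = (∂ψ/∂x_i - √-1 ∂ψ/∂y_i) / 2` for a real valued `ψ`. -/
def dz (ψ : Space n → ℝ) (i : Fin n) (z : Space n) : ℂ :=
  ((fderiv ℝ ψ z (EuclideanSpace.single i 1) : ℝ) -
    Complex.I * (fderiv ℝ ψ z (EuclideanSpace.single i Complex.I) : ℝ)) / 2

/-- The complex Hessian `∂²f/∂z_i ∂z̄_j
= (f_{x_i x_j} + f_{y_i y_j} + √-1 (f_{x_i y_j} - f_{y_i x_j})) / 4` of a real valued `f`. -/
def complexHessian (f : Space n → ℝ) (z : Space n) : Matrix (Fin n) (Fin n) ℂ :=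
  Matrix.of fun i j =>
    let H : Space n → Space n → ℝ := fun v w => iteratedFDeriv ℝ 2 f z ![v, w]
    let e : Fin n → Space n := fun i => EuclideanSpace.single i 1
    let e' : Fin n → Space n := fun i => EuclideanSpace.single i Complex.I
    (((H (e i) (e j) + H (e' i) (e' j) : ℝ) : ℂ) +
      Complex.I * ((H (e i) (e' j) - H (e' i) (e j) : ℝ) : ℂ)) / 4

/-- The Laplace-Beltrami operator of a Kähler metric whose matrix at `z` is `G = (g_{i j̄})`.
The underlying Riemannian metric is the real part of `∑ g_{i j̄} dz_i ⊗ dz̄_j` (so `dz ⊗ dz̄` is the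
Euclidean metric of `ℂ`), and `Δ_g f = 4 g^{i j̄} ∂²f/∂z_i ∂z̄_j`. -/
def laplacian (G : Matrix (Fin n) (Fin n) ℂ) (f : Space n → ℝ) (z : Space n) : ℝ :=
  4 * (G⁻¹ * complexHessian f z).trace.re

/-- The closedness `∂g_{i j̄}/∂z_k = ∂g_{k j̄}/∂z_i` of the form `∑ g_{i j̄} dz_i ∧ dz̄_j` on an open
set, in the sense of distributions, since the metrics are only Hölder continuous in space. -/
def IsWeaklyClosed (Ω : Set (Space n)) (g : Space n → Matrix (Fin n) (Fin n) ℂ) : Prop :=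
  ∀ ψ : Space n → ℝ, ContDiff ℝ ∞ ψ → HasCompactSupport ψ → tsupport ψ ⊆ Ω →
    ∀ i j k : Fin n, ∫ z, g z i j * dz ψ k z = ∫ z, g z k j * dz ψ i z

/-- Local Hölder continuity on an open set, with some exponent. -/
def IsLocallyHolder (Ω : Set (Space n)) (f : Space n → ℂ) : Prop :=
  ∀ z ∈ Ω, ∃ (C α : NNReal) (U : Set (Space n)), 0 < α ∧ U ∈ 𝓝 z ∧ HolderOnWith C α f U

/-- `g` is (the matrix, in holomorphic coordinates, of) a time-differentiable family of Kähler
metrics on the slant cylinder minus `D` which has quasi-isometric constant `K` with respect to the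
model metric and whose volume form `det(g_{i j̄}) dV_z` satisfies `∂dvol/∂t ≤ K dvol`.
For `ε = 0` these are the weak-conic families. For `ε > 0` they are the `ε`-nearly-conic families,
for which nothing is required on `D` here. -/
structure IsConicFamily (c : ConeData n) (ε : ℝ) (S : SlantCylinder n) (K : ℝ)
    (g : Space n × ℝ → Matrix (Fin n) (Fin n) ℂ) : Prop where
  posDef : ∀ X ∈ S.closedDomain c ε, (g X).PosDef
  holder : ∀ t ∈ Set.Icc S.T₀ S.T₁, ∀ i j : Fin n,
    IsLocallyHolder (S.slice c ε t) fun z => g (z, t) i j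
  closed : ∀ t ∈ Set.Icc S.T₀ S.T₁, IsWeaklyClosed (S.slice c ε t) fun z => g (z, t)
  lower : ∀ X ∈ S.closedDomain c ε, (g X - ((K⁻¹ : ℝ) : ℂ) • c.modelMetric ε X.1).PosSemidef
  upper : ∀ X ∈ S.closedDomain c ε, ((K : ℂ) • c.modelMetric ε X.1 - g X).PosSemidef
  time_diff : ∀ X ∈ S.closedDomain c ε, ∀ i j : Fin n,
    DifferentiableWithinAt ℝ (fun s => g (X.1, s) i j) (Set.Icc S.T₀ S.T₁) X.2
  volume_le : ∀ X ∈ S.closedDomain c ε,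
    derivWithin (fun s => (g (X.1, s)).det.re) (Set.Icc S.T₀ S.T₁) X.2 ≤ K * (g X).det.re

/-! ### Weak subsolutions -/

/-- Local Hölder continuity of exponent `α` with respect to the parabolic distance
`|x - y| + |t - s|^{1/2}`. -/
def IsLocallyParabolicHolder {F : Type*} [NormedAddCommGroup F] (α : ℝ) (Q : Set (Space n × ℝ))
    (f : Space n × ℝ → F) : Prop :=
  ∀ X ∈ Q, ∃ (C : ℝ) (U : Set (Space n × ℝ)), U ∈ 𝓝 X ∧ ∀ Y ∈ U ∩ Q, ∀ Z ∈ U ∩ Q,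
    ‖f Y - f Z‖ ≤ C * (‖Y.1 - Z.1‖ + Real.sqrt |Y.2 - Z.2|) ^ α

/-- The time derivative of `u` on the time interval `[T₀, T₁]` (one-sided at the end points). -/
def timeDeriv (S : SlantCylinder n) (u : Space n × ℝ → ℝ) (X : Space n × ℝ) : ℝ :=
  derivWithin (fun s => u (X.1, s)) (Set.Icc S.T₀ S.T₁) X.2

/-- `u` is of class `C^{2+α, 1+α/2}`, locally on the slant cylinder minus `D`, up to the initial
and final times. -/
structure IsParabolicC2 (c : ConeData n) (ε : ℝ) (S : SlantCylinder n) (α : ℝ)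
    (u : Space n × ℝ → ℝ) : Prop where
  space_diff : ∀ X ∈ S.closedDomain c ε, ContDiffAt ℝ 2 (fun z => u (z, X.2)) X.1
  time_diff : ∀ X ∈ S.closedDomain c ε,
    DifferentiableWithinAt ℝ (fun s => u (X.1, s)) (Set.Icc S.T₀ S.T₁) X.2
  holder : IsLocallyParabolicHolder α (S.closedDomain c ε) u
  holder_fderiv : IsLocallyParabolicHolder α (S.closedDomain c ε)
    fun X => fderiv ℝ (fun z => u (z, X.2)) X.1
  holder_hessian : IsLocallyParabolicHolder α (S.closedDomain c ε)
    fun X => iteratedFDeriv ℝ 2 (fun z => u (z, X.2)) X.1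
  holder_time : IsLocallyParabolicHolder α (S.closedDomain c ε) (timeDeriv S u)

/-- `u` is a weak subsolution of `∂u/∂t - Δ_g u ≤ 0` in the slant cylinder: it is of class
`C^{2+α, 1+α/2}` away from `D`, satisfies the inequality there in the classical sense, and is
bounded. -/
structure IsWeakSubsolution (c : ConeData n) (ε : ℝ) (S : SlantCylinder n)
    (g : Space n × ℝ → Matrix (Fin n) (Fin n) ℂ) (u : Space n × ℝ → ℝ) : Prop where
  regular : ∃ α : ℝ, 0 < α ∧ α < 1 ∧ IsParabolicC2 c ε S α u
  bounded : ∃ M : ℝ, ∀ X ∈ S.domain c ε, |u X| ≤ M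
  subsolution : ∀ X ∈ S.closedDomain c ε,
    timeDeriv S u X - laplacian (g X) (fun z => u (z, X.2)) X.1 ≤ 0

end Conic

end

/-!
The two-sided bound `K⁻¹ m ≤ g ≤ K m` by the model metric `m` allows `u` to be compared with one
explicit barrier for all the operators `∂_t - Δ_g` at once, by the maximum principle. The two points
that need care are the divisor `D` and the choice of a distance.

*The divisor.* The functions `log |z_j|` are pluriharmonic, hence harmonic for every `g`, and tend
to `-∞` on `D`. Adding `δ ∑ log |z_j|` to a bounded function therefore keeps the maximum
away from `D`. In fact all coordinate hyperplanes are removed in this way, so that all coordinates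
can be treated alike, with cone parameter `1` for those not defining `D`; the remaining points
are recovered by continuity.

*The distance.* The Laplacian of `|ξ - y|²` is unbounded near `D` when `y ∉ D`. It is replaced by
`∑ d(ξ_j, y_j)²`, where `d(ξ, w)² = |ξ|² + |w|² - 2 |ξ| |w| cos (γ ∠(ξ, w))` and `d` is the distance
in a flat cone of angle `2πγ`, with `γ` at most every cone parameter (`coneDist`). It satisfies
`γ |ξ - w| ≤ d(ξ, w)`, it is a contraction in each variable, and `d²` is a minimum of smooth
branches. Uniformly in `ε`, each branch has Laplacian bounded above (`coneBranchDeriv₂_add_le`) and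
gradient at least a multiple of `d` (`le_norm_coneGrad_sq`). Taking a minimum is harmless since `d²`
enters the barrier with a negative sign.

With `gap = R² - ∑ d(ξ_j, y_j(t))²` and `R = γ r / 2`, the barrier is
`ψ = exp (-A (t - T₀)) gap² / R⁴`, with `A` of order `r⁻²`. Where `gap` is small, the gradient term
in `Δ_g gap²` makes `ψ` a subsolution, and elsewhere the exponential factor does; the motion of
the center costs only `r |y'|`, the parabolic slope. Hence `u ≤ M (1 - ψ)` with `M = sup u⁺`
(`le_barrier`), and `ψ = exp (-A (T₁ - T₀))` at `Y`.

Second derivatives are taken along the curves `z_j exp (τ w_j / z_j)`, on which `log |z_j|` is affine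
and the branches of `d²` are explicit. Writing `G⁻¹ = Bᴴ B`, the Laplacian is the sum, over the
rows `w` of `B`, of the Laplacians along the complex directions `w` (`laplacian_eq_sum`).
-/

noncomputable section

namespace Conic

/-! ### The polar radius -/

section PolarRadius

/-- `ds/dρ` for the polar radius `s`. -/
def polarSpeed (b ε ρ : ℝ) : ℝ := b / (ρ ^ 2 + ε ^ 2) ^ ((1 - b) / 2)

variable {b ε ρ : ℝ}

theorem polarSpeed_pos (hb : 0 < b) (hρ : 0 < ρ) : 0 < polarSpeed b ε ρ := by
  unfold polarSpeed; positivity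

theorem polarSpeed_nonneg (hb : 0 < b) : 0 ≤ polarSpeed b ε ρ := by
  unfold polarSpeed; positivity

theorem polarSpeed_sq : polarSpeed b ε ρ ^ 2 = b ^ 2 / (ρ ^ 2 + ε ^ 2) ^ (1 - b) := by
  unfold polarSpeed
  rw [div_pow, ← Real.rpow_natCast (_ ^ ((1 - b) / 2)), ← Real.rpow_mul (by positivity)]
  congr 2
  push_cast
  ring

theorem hasDerivAt_polarSpeed (hρ : 0 < ρ) :
    HasDerivAt (polarSpeed b ε)
      (-((1 - b) * ρ / (ρ ^ 2 + ε ^ 2)) * polarSpeed b ε ρ) ρ := by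
  have h0 : 0 < ρ ^ 2 + ε ^ 2 := by positivity
  have h1 : HasDerivAt (fun x : ℝ => x ^ 2 + ε ^ 2) (2 * ρ) ρ := by
    simpa using (hasDerivAt_pow 2 ρ).add_const (ε ^ 2)
  have h2 := (h1.rpow_const (p := -((1 - b) / 2)) (Or.inl h0.ne')).const_mul b
  have e : polarSpeed b ε = fun x => b * (x ^ 2 + ε ^ 2) ^ (-((1 - b) / 2)) := by
    funext x
    rw [polarSpeed, Real.rpow_neg (by positivity), div_eq_mul_inv]
  rw [e]
  refine h2.congr_deriv ?_
  rw [Real.rpow_sub_one h0.ne']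
  field_simp

theorem intervalIntegrable_polarSpeed (hb : 0 < b) (hρ : 0 ≤ ρ) :
    IntervalIntegrable (polarSpeed b ε) MeasureTheory.volume 0 ρ := by
  rcases eq_or_ne ε 0 with rfl | hε
  · have h := (intervalIntegral.intervalIntegrable_rpow' (a := 0) (b := ρ)
      (by linarith : -1 < b - 1)).const_mul b
    refine h.congr fun x hx => ?_
    rw [Set.uIoc_of_le hρ] at hx
    have hx0 : 0 < x := hx.1
    have e : (x ^ 2 + (0 : ℝ) ^ 2) ^ ((1 - b) / 2) = x ^ (1 - b) := by
      have : x ^ 2 + (0 : ℝ) ^ 2 = x ^ (2 : ℝ) := by norm_num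
      rw [this, ← Real.rpow_mul hx0.le]
      congr 1
      ring
    simp only [polarSpeed, e]
    rw [div_eq_mul_inv, ← Real.rpow_neg hx0.le, neg_sub]
  · apply Continuous.intervalIntegrable
    unfold polarSpeed
    have h : ∀ x : ℝ, x ^ 2 + ε ^ 2 ≠ 0 := fun x => by positivity
    refine continuous_const.div ?_ fun x => ?_
    · exact Continuous.rpow_const (by fun_prop) fun x => Or.inl (h x)
    · have : 0 < x ^ 2 + ε ^ 2 := by positivity
      positivity

theorem hasDerivAt_polarRadius (hb : 0 < b) (hρ : 0 < ρ) :
    HasDerivAt (polarRadius b ε) (polarSpeed b ε ρ) ρ := by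
  refine intervalIntegral.integral_hasDerivAt_right (f := polarSpeed b ε)
    (intervalIntegrable_polarSpeed hb hρ.le) ?_ (hasDerivAt_polarSpeed hρ).continuousAt
  refine (Measurable.stronglyMeasurable ?_).stronglyMeasurableAtFilter
  unfold polarSpeed
  fun_prop

theorem polarRadius_nonneg (hb : 0 < b) (hρ : 0 ≤ ρ) : 0 ≤ polarRadius b ε ρ :=
  intervalIntegral.integral_nonneg hρ fun _ _ => polarSpeed_nonneg hb

/-- The speed decreases with the radius, so the polar radius is at least `ρ s'(ρ)`. -/
theorem mul_polarSpeed_le_polarRadius (hb : 0 < b) (hb1 : b ≤ 1) (hρ : 0 < ρ) :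
    ρ * polarSpeed b ε ρ ≤ polarRadius b ε ρ := by
  have h : ∫ _ in (0 : ℝ)..ρ, polarSpeed b ε ρ ≤ ∫ x in (0 : ℝ)..ρ, polarSpeed b ε x := by
    refine intervalIntegral.integral_mono_on_of_le_Ioo hρ.le intervalIntegrable_const
      (intervalIntegrable_polarSpeed hb hρ.le) fun x hx => ?_
    have hx0 := hx.1
    have hx1 := hx.2
    unfold polarSpeed
    gcongr
  rw [intervalIntegral.integral_const, sub_zero, smul_eq_mul] at h
  exact h

/-- The speed decreases more slowly than `ρ ^ (b - 1)`, the speed for `ε = 0`. -/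
theorem mul_polarRadius_le (hb : 0 < b) (hb1 : b ≤ 1) (hρ : 0 < ρ) :
    b * polarRadius b ε ρ ≤ ρ * polarSpeed b ε ρ := by
  have h : ∫ x in (0 : ℝ)..ρ, polarSpeed b ε x ≤
      ∫ x in (0 : ℝ)..ρ, polarSpeed b ε ρ * ρ ^ (1 - b) * x ^ (b - 1) := by
    refine intervalIntegral.integral_mono_on_of_le_Ioo hρ.le
      (intervalIntegrable_polarSpeed hb hρ.le)
      ((intervalIntegral.intervalIntegrable_rpow' (by linarith)).const_mul _) fun x hx => ?_
    have hx0 := hx.1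
    have hx1 := hx.2
    have e : x ^ (b - 1) = (x ^ (1 - b))⁻¹ := by rw [← Real.rpow_neg hx0.le]; congr 1; ring
    have key : x ^ (1 - b) * (ρ ^ 2 + ε ^ 2) ^ ((1 - b) / 2) ≤
        ρ ^ (1 - b) * (x ^ 2 + ε ^ 2) ^ ((1 - b) / 2) := by
      have sq : ∀ y : ℝ, 0 < y → y ^ (1 - b) = (y ^ 2) ^ ((1 - b) / 2) := fun y hy => by
        rw [← Real.rpow_natCast y 2, ← Real.rpow_mul hy.le]; congr 1; push_cast; ring
      rw [sq x hx0, sq ρ hρ, ← Real.mul_rpow (by positivity) (by positivity),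
        ← Real.mul_rpow (by positivity) (by positivity)]
      refine Real.rpow_le_rpow (by positivity) ?_ (by linarith)
      have : x ^ 2 ≤ ρ ^ 2 := by gcongr
      nlinarith [sq_nonneg ε]
    rw [e]
    unfold polarSpeed
    have p1 : 0 < (x ^ 2 + ε ^ 2) ^ ((1 - b) / 2) := by positivity
    have p2 : 0 < (ρ ^ 2 + ε ^ 2) ^ ((1 - b) / 2) := by positivity
    have p3 : 0 < x ^ (1 - b) := by positivity
    rw [← div_eq_mul_inv, div_mul_eq_mul_div, div_div, div_le_div_iff₀ p1 (by positivity)]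
    nlinarith [mul_le_mul_of_nonneg_left key hb.le]
  rw [intervalIntegral.integral_const_mul, integral_rpow (Or.inl (by linarith)),
    sub_add_cancel, Real.zero_rpow hb.ne', sub_zero] at h
  have e2 : ρ ^ (1 - b) * ρ ^ b = ρ := by
    rw [← Real.rpow_add hρ]; simp
  have h' : polarRadius b ε ρ ≤ polarSpeed b ε ρ * (ρ ^ (1 - b) * ρ ^ b) / b := by
    calc _ ≤ _ := h
      _ = _ := by ring
  rw [e2, le_div_iff₀ hb] at h'
  linarith

theorem polarRadius_pos (hb : 0 < b) (hb1 : b ≤ 1) (hρ : 0 < ρ) : 0 < polarRadius b ε ρ :=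
  lt_of_lt_of_le (mul_pos hρ (polarSpeed_pos hb hρ)) (mul_polarSpeed_le_polarRadius hb hb1 hρ)

/-- The polar radius is a proper function of `ρ`. -/
theorem exists_bound_of_polarRadius_le (hb : 0 < b) (hb1 : b ≤ 1) (s : ℝ) :
    ∃ Z : ℝ, 0 < Z ∧ ∀ ρ : ℝ, 0 ≤ ρ → polarRadius b ε ρ ≤ s → ρ ≤ Z := by
  have h2 : 0 < (1 + ε ^ 2) ^ ((1 - b) / 2) := by positivity
  refine ⟨max 1 ((|s| * (1 + ε ^ 2) ^ ((1 - b) / 2) / b) ^ (b⁻¹)), by positivity, ?_⟩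
  intro ρ _ hs
  by_contra! hρ
  rw [max_lt_iff] at hρ
  have hρ0 : 0 < ρ := by linarith
  have h1 := (mul_polarSpeed_le_polarRadius (ε := ε) hb hb1 hρ0).trans (hs.trans (le_abs_self s))
  have h3 : (ρ ^ 2 + ε ^ 2) ^ ((1 - b) / 2) ≤ ρ ^ (1 - b) * (1 + ε ^ 2) ^ ((1 - b) / 2) := by
    have : ρ ^ (1 - b) = (ρ ^ 2) ^ ((1 - b) / 2) := by
      rw [← Real.rpow_natCast ρ 2, ← Real.rpow_mul hρ0.le]; congr 1; push_cast; ring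
    rw [this, ← Real.mul_rpow (by positivity) (by positivity)]
    refine Real.rpow_le_rpow (by positivity) ?_ (by linarith)
    nlinarith [sq_nonneg ε, hρ.1, mul_nonneg (sq_nonneg ε) (by nlinarith : 0 ≤ ρ ^ 2 - 1)]
  have h4 : ρ ^ b * b ≤ |s| * (1 + ε ^ 2) ^ ((1 - b) / 2) := by
    have p : 0 < (ρ ^ 2 + ε ^ 2) ^ ((1 - b) / 2) := by positivity
    unfold polarSpeed at h1
    rw [← mul_div_assoc, div_le_iff₀ p] at h1
    have e2 : ρ ^ (1 - b) * ρ ^ b = ρ := by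
      rw [← Real.rpow_add hρ0]; simp
    have h5 : ρ ^ (1 - b) * (ρ ^ b * b) ≤ ρ ^ (1 - b) * (|s| * (1 + ε ^ 2) ^ ((1 - b) / 2)) := by
      calc _ = ρ * b := by rw [← mul_assoc, e2]
        _ ≤ _ := h1
        _ ≤ |s| * (ρ ^ (1 - b) * (1 + ε ^ 2) ^ ((1 - b) / 2)) := by gcongr
        _ = _ := by ring
    exact le_of_mul_le_mul_left h5 (by positivity)
  have h6 : ρ ^ b ≤ |s| * (1 + ε ^ 2) ^ ((1 - b) / 2) / b := by rwa [le_div_iff₀ hb]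
  have h7 := Real.rpow_le_rpow (by positivity) h6 (inv_nonneg.2 hb.le)
  rw [← Real.rpow_mul hρ0.le, mul_inv_cancel₀ hb.ne', Real.rpow_one] at h7
  linarith [hρ.2]

end PolarRadius

/-! ### The distance in a flat cone -/

section ConeDist

/-- The distance between the points with polar coordinates `ξ` and `w` in the flat cone of total
angle `2πγ`: the third side of the planar triangle with sides `|ξ|`, `|w|` and
angle `γ ∠(ξ, w)` between them. -/
def coneDist (γ : ℝ) (ξ w : ℂ) : ℝ :=
  ‖(‖ξ‖ : ℂ) - ‖w‖ * Complex.exp ((γ * InnerProductGeometry.angle ξ w : ℝ) * Complex.I)‖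

theorem norm_sub_exp_sq (p q x y : ℝ) :
    ‖p * Complex.exp (x * Complex.I) - q * Complex.exp (y * Complex.I)‖ ^ 2 =
      p ^ 2 + q ^ 2 - 2 * p * q * Real.cos (x - y) := by
  rw [← Complex.normSq_eq_norm_sq, Complex.normSq_apply]
  simp only [Complex.sub_re, Complex.sub_im, Complex.re_ofReal_mul, Complex.im_ofReal_mul,
    Complex.exp_ofReal_mul_I_re, Complex.exp_ofReal_mul_I_im, Real.cos_sub]
  linear_combination p ^ 2 * Real.sin_sq_add_cos_sq x + q ^ 2 * Real.sin_sq_add_cos_sq y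

variable {γ : ℝ} {ξ w : ℂ}

theorem coneDist_sq : coneDist γ ξ w ^ 2 =
    ‖ξ‖ ^ 2 + ‖w‖ ^ 2 - 2 * ‖ξ‖ * ‖w‖ * Real.cos (γ * InnerProductGeometry.angle ξ w) := by
  have h := norm_sub_exp_sq ‖ξ‖ ‖w‖ 0 (γ * InnerProductGeometry.angle ξ w)
  simp only [Complex.ofReal_zero, zero_mul, Complex.exp_zero, mul_one, zero_sub,
    Real.cos_neg] at h
  exact h

theorem coneDist_nonneg : 0 ≤ coneDist γ ξ w := norm_nonneg _

theorem coneDist_comm : coneDist γ ξ w = coneDist γ w ξ := by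
  rw [← sq_eq_sq₀ coneDist_nonneg coneDist_nonneg, coneDist_sq, coneDist_sq,
    InnerProductGeometry.angle_comm]
  ring

@[simp]
theorem coneDist_self : coneDist γ ξ ξ = 0 := by
  rw [← sq_eq_zero_iff, coneDist_sq]
  rcases eq_or_ne ξ 0 with rfl | h
  · simp
  · rw [InnerProductGeometry.angle_self h]
    simp
    ring

theorem norm_sub_sq_eq_angle (x y : ℂ) : ‖x - y‖ ^ 2 =
    ‖x‖ ^ 2 + ‖y‖ ^ 2 - 2 * ‖x‖ * ‖y‖ * Real.cos (InnerProductGeometry.angle x y) := by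
  have := InnerProductGeometry.norm_sub_sq_eq_norm_sq_add_norm_sq_sub_two_mul_norm_mul_norm_mul_cos_angle x y
  rw [sq, sq, sq, this]

theorem abs_coneDist_sub_le (hγ : 0 ≤ γ) (hγ1 : γ ≤ 1) (ξ w w' : ℂ) :
    |coneDist γ ξ w - coneDist γ ξ w'| ≤ ‖w - w'‖ := by
  refine (abs_norm_sub_norm_le _ _).trans ?_
  set α := InnerProductGeometry.angle ξ w
  set α' := InnerProductGeometry.angle ξ w'
  rw [sub_sub_sub_cancel_left, ← sq_le_sq₀ (norm_nonneg _) (norm_nonneg _), norm_sub_exp_sq,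
    norm_sub_sq_eq_angle]
  have h1 : |α - α'| ≤ InnerProductGeometry.angle w w' := by
    have h1 := InnerProductGeometry.angle_le_angle_add_angle ξ w w'
    have h2 := InnerProductGeometry.angle_le_angle_add_angle ξ w' w
    rw [InnerProductGeometry.angle_comm w' w] at h2
    rw [abs_le]
    constructor <;> linarith
  have h2 : Real.cos (InnerProductGeometry.angle w w') ≤ Real.cos (γ * α' - γ * α) := by
    rw [← Real.cos_abs (γ * α' - γ * α), ← mul_sub, abs_mul, abs_of_nonneg hγ, abs_sub_comm]
    refine Real.cos_le_cos_of_nonneg_of_le_pi (by positivity)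
      (InnerProductGeometry.angle_le_pi _ _) ?_
    nlinarith [abs_nonneg (α - α')]
  have h3 : 0 ≤ 2 * ‖w‖ * ‖w'‖ := by positivity
  nlinarith [mul_le_mul_of_nonneg_left h2 h3]

theorem continuous_coneDist (hγ : 0 ≤ γ) (hγ1 : γ ≤ 1) :
    Continuous fun p : ℂ × ℂ => coneDist γ p.1 p.2 := by
  have h : LipschitzWith 2 fun p : ℂ × ℂ => coneDist γ p.1 p.2 := by
    refine LipschitzWith.of_dist_le_mul fun p q => ?_
    have h1 := abs_coneDist_sub_le hγ hγ1 p.1 p.2 q.2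
    have h2 := abs_coneDist_sub_le hγ hγ1 q.2 p.1 q.1
    rw [coneDist_comm, coneDist_comm (ξ := q.2)] at h2
    have h3 : ‖p.1 - q.1‖ ≤ dist p q := norm_fst_le (p - q) |>.trans_eq (dist_eq_norm _ _).symm
    have h4 : ‖p.2 - q.2‖ ≤ dist p q := norm_snd_le (p - q) |>.trans_eq (dist_eq_norm _ _).symm
    rw [Real.dist_eq]
    have h5 := abs_sub_le (coneDist γ p.1 p.2) (coneDist γ p.1 q.2) (coneDist γ q.1 q.2)
    simp only [NNReal.coe_ofNat]
    linarith
  exact h.continuous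

theorem mul_norm_sub_le_coneDist (hγ : 0 ≤ γ) (hγ1 : γ ≤ 1) :
    γ * ‖ξ - w‖ ≤ coneDist γ ξ w := by
  rw [← sq_le_sq₀ (by positivity) coneDist_nonneg, mul_pow, coneDist_sq, norm_sub_sq_eq_angle]
  set α := InnerProductGeometry.angle ξ w
  have h0 : 0 ≤ α := InnerProductGeometry.angle_nonneg _ _
  have hπ : α ≤ Real.pi := InnerProductGeometry.angle_le_pi _ _
  have h1 : γ * Real.sin (α / 2) ≤ Real.sin (γ * (α / 2)) := by
    have := strictConcaveOn_sin_Icc.concaveOn.2 (Set.left_mem_Icc.2 Real.pi_pos.le)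
      (show α / 2 ∈ Set.Icc 0 Real.pi from ⟨by positivity, by linarith⟩)
      (sub_nonneg.2 hγ1) hγ (sub_add_cancel 1 γ)
    simpa using this
  have h2 : 0 ≤ Real.sin (α / 2) := Real.sin_nonneg_of_nonneg_of_le_pi (by positivity) (by linarith)
  have h3 : (γ * Real.sin (α / 2)) ^ 2 ≤ Real.sin (γ * (α / 2)) ^ 2 := by gcongr
  have e : ∀ x : ℝ, Real.cos x = 1 - 2 * Real.sin (x / 2) ^ 2 := fun x => by
    have h := Real.cos_sq' (x / 2)
    have h' := Real.cos_sq (x / 2)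
    rw [mul_div_cancel₀ x two_ne_zero] at h'
    linarith
  rw [e α, e (γ * α), mul_div_assoc]
  have h4 : 0 ≤ ‖ξ‖ * ‖w‖ := by positivity
  have h5 : 0 ≤ (1 - γ ^ 2) * (‖ξ‖ - ‖w‖) ^ 2 := mul_nonneg (by nlinarith) (sq_nonneg _)
  nlinarith [mul_le_mul_of_nonneg_left h3 h4]

/-- At each `ξ₀ ≠ 0` the squared cone distance from `w` is touched from above by the smooth
function `|ξ|² + |w|² - 2 |ξ| |w| cos (γ (Θ + y))`, where `y` is the angle turned from `ξ₀` to `ξ`.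
It is a branch of the squared cone distance, which is the minimum of its branches. -/
theorem exists_angle_coneDist_sq_le (hγ : 0 ≤ γ) (hγ1 : γ ≤ 1 / 2) {ξ₀ : ℂ} (hξ : ξ₀ ≠ 0) (w : ℂ) :
    ∃ Θ : ℝ, |Θ| ≤ Real.pi ∧
      coneDist γ ξ₀ w ^ 2 = ‖ξ₀‖ ^ 2 + ‖w‖ ^ 2 - 2 * ‖ξ₀‖ * ‖w‖ * Real.cos (γ * Θ) ∧
      ∀ y s : ℝ, |y| ≤ Real.pi → 0 < s →
        coneDist γ (s * Complex.exp (y * Complex.I) * ξ₀) w ^ 2 ≤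
          (s * ‖ξ₀‖) ^ 2 + ‖w‖ ^ 2 - 2 * (s * ‖ξ₀‖) * ‖w‖ * Real.cos (γ * (Θ + y)) := by
  rcases eq_or_ne w 0 with rfl | hw
  · refine ⟨0, by simp [Real.pi_pos.le], by rw [coneDist_sq]; simp, fun y s _ hs => ?_⟩
    rw [coneDist_sq]
    simp [Complex.norm_exp_ofReal_mul_I, abs_of_pos hs]
  · have hd : ξ₀ / w ≠ 0 := div_ne_zero hξ hw
    refine ⟨(ξ₀ / w).arg, Complex.abs_arg_le_pi _, ?_, fun y s hy hs => ?_⟩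
    · rw [coneDist_sq, Complex.angle_eq_abs_arg hξ hw, ← Real.cos_abs (γ * (ξ₀ / w).arg), abs_mul,
        abs_of_nonneg hγ]
    · have hs' : (s : ℂ) ≠ 0 := by exact_mod_cast hs.ne'
      have hξ' : s * Complex.exp (y * Complex.I) * ξ₀ ≠ 0 :=
        mul_ne_zero (mul_ne_zero hs' (Complex.exp_ne_zero _)) hξ
      rw [coneDist_sq, Complex.angle_eq_abs_arg hξ' hw]
      have hn : ‖s * Complex.exp (y * Complex.I) * ξ₀‖ = s * ‖ξ₀‖ := by
        simp [Complex.norm_exp_ofReal_mul_I, abs_of_pos hs]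
      rw [hn]
      set Θ := (ξ₀ / w).arg with hΘ
      have hc : Real.cos ((s * Complex.exp (y * Complex.I) * ξ₀ / w).arg) = Real.cos (Θ + y) := by
        rw [Complex.cos_arg (div_ne_zero hξ' hw)]
        have e : s * Complex.exp (y * Complex.I) * ξ₀ / w =
            (s * ‖ξ₀ / w‖ : ℝ) * Complex.exp ((Θ + y : ℝ) * Complex.I) := by
          have := Complex.norm_mul_exp_arg_mul_I (ξ₀ / w)
          rw [mul_div_assoc, ← this, ← hΘ]
          push_cast
          rw [add_mul, Complex.exp_add]
          simp only [Complex.norm_mul, Complex.norm_exp_ofReal_mul_I, Complex.norm_real, norm_norm,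
            norm_div, mul_one]
          ring
        have hp : 0 < s * ‖ξ₀ / w‖ := mul_pos hs (norm_pos_iff.2 hd)
        rw [e, Complex.re_ofReal_mul, Complex.exp_ofReal_mul_I_re, Complex.norm_mul,
          Complex.norm_exp_ofReal_mul_I, Complex.norm_real, Real.norm_of_nonneg hp.le, mul_one,
          mul_div_cancel_left₀ _ hp.ne']
      set α := (s * Complex.exp (y * Complex.I) * ξ₀ / w).arg
      have hα : |α| ≤ |Θ + y| := by
        by_contra! hlt
        have h1 : |α| ≤ Real.pi := Complex.abs_arg_le_pi _
        have h2 := Real.strictAntiOn_cos ⟨abs_nonneg (Θ + y), (hlt.le.trans h1)⟩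
          ⟨abs_nonneg α, h1⟩ hlt
        rw [Real.cos_abs, Real.cos_abs, hc] at h2
        exact lt_irrefl _ h2
      have hcos : Real.cos (γ * (Θ + y)) ≤ Real.cos (γ * |α|) := by
        rw [← Real.cos_abs (γ * (Θ + y)), abs_mul, abs_of_nonneg hγ]
        refine Real.cos_le_cos_of_nonneg_of_le_pi (by positivity) ?_ (by gcongr)
        have h1 : |Θ + y| ≤ 2 * Real.pi := by
          have h2 : |Θ| ≤ Real.pi := Complex.abs_arg_le_pi _
          have := abs_add_le Θ y
          linarith
        nlinarith [abs_nonneg (Θ + y)]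
      have h3 : 0 ≤ 2 * (s * ‖ξ₀‖) * ‖w‖ := by positivity
      nlinarith [mul_le_mul_of_nonneg_left hcos h3]

end ConeDist

/-! ### Branches of the squared cone distance along logarithmic curves -/

section ConeBranch

/-- `ρ ds/dρ`, the derivative of the polar radius `s` with respect to `log ρ`. -/
def logSpeed (b ε ρ : ℝ) : ℝ := ρ * polarSpeed b ε ρ

/-- The second derivative of the polar radius with respect to `log ρ`. -/
def logAccel (b ε ρ : ℝ) : ℝ := (1 - (1 - b) * ρ ^ 2 / (ρ ^ 2 + ε ^ 2)) * logSpeed b ε ρ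

variable {b ε ρ : ℝ}

theorem logSpeed_pos (hb : 0 < b) (hρ : 0 < ρ) : 0 < logSpeed b ε ρ :=
  mul_pos hρ (polarSpeed_pos hb hρ)

theorem logAccel_mem_Icc (hb : 0 < b) (hb1 : b ≤ 1) (hρ : 0 < ρ) :
    logAccel b ε ρ ∈ Set.Icc (b * logSpeed b ε ρ) (logSpeed b ε ρ) := by
  have h0 : 0 < ρ ^ 2 + ε ^ 2 := by positivity
  have hB := (logSpeed_pos (ε := ε) hb hρ).le
  have h1 : 0 ≤ (1 - b) * ρ ^ 2 / (ρ ^ 2 + ε ^ 2) :=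
    div_nonneg (mul_nonneg (by linarith) (by positivity)) h0.le
  have h2 : (1 - b) * ρ ^ 2 / (ρ ^ 2 + ε ^ 2) ≤ 1 - b := by
    rw [div_le_iff₀ h0]
    nlinarith [sq_nonneg ε]
  unfold logAccel
  constructor <;> nlinarith

theorem hasDerivAt_polarRadius_exp (hb : 0 < b) (hρ : 0 < ρ) (a t : ℝ) :
    HasDerivAt (fun t => polarRadius b ε (ρ * Real.exp (t * a)))
      (a * logSpeed b ε (ρ * Real.exp (t * a))) t := by
  have h1 : HasDerivAt (fun t : ℝ => ρ * Real.exp (t * a)) (ρ * (Real.exp (t * a) * a)) t := by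
    simpa using (((hasDerivAt_id t).mul_const a).exp).const_mul ρ
  refine ((hasDerivAt_polarRadius (ε := ε) hb (by positivity)).comp t h1).congr_deriv ?_
  simp only [logSpeed]
  ring

theorem hasDerivAt_logSpeed_exp (hρ : 0 < ρ) (a : ℝ) :
    HasDerivAt (fun t => logSpeed b ε (ρ * Real.exp (t * a))) (a * logAccel b ε ρ) 0 := by
  have h1 : HasDerivAt (fun t : ℝ => ρ * Real.exp (t * a)) (ρ * a) 0 := by
    simpa using (((hasDerivAt_id (0 : ℝ)).mul_const a).exp).const_mul ρ
  have h2 : HasDerivAt (polarSpeed b ε)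
      (-((1 - b) * ρ / (ρ ^ 2 + ε ^ 2)) * polarSpeed b ε ρ) (ρ * Real.exp (0 * a)) := by
    simpa using hasDerivAt_polarSpeed hρ
  have h3 := HasDerivAt.comp (h₂ := polarSpeed b ε) 0 h2 h1
  refine (h1.fun_mul h3).congr_deriv ?_
  have h0 : ρ ^ 2 + ε ^ 2 ≠ 0 := by positivity
  simp only [logAccel, logSpeed, Function.comp_apply, zero_mul, Real.exp_zero, mul_one]
  field_simp
  ring

/-- A branch of the squared cone distance from a point at polar radius `q`, along the curve
`z₀ exp (t (a + √-1 c))` with `|z₀| = ρ`, where `Θ` is the initial value of the angle. -/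
def coneBranch (b ε γ ρ q Θ a c t : ℝ) : ℝ :=
  polarRadius b ε (ρ * Real.exp (t * a)) ^ 2 + q ^ 2 -
    2 * polarRadius b ε (ρ * Real.exp (t * a)) * q * Real.cos (γ * (Θ + t * c))

/-- The derivative of `coneBranch`. -/
def coneBranchDeriv (b ε γ ρ q Θ a c t : ℝ) : ℝ :=
  2 * a * logSpeed b ε (ρ * Real.exp (t * a)) *
      (polarRadius b ε (ρ * Real.exp (t * a)) - q * Real.cos (γ * (Θ + t * c))) +
    2 * c * γ * q * polarRadius b ε (ρ * Real.exp (t * a)) * Real.sin (γ * (Θ + t * c))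

/-- The second derivative of `coneBranch` at `0`. -/
def coneBranchDeriv₂ (b ε γ ρ q Θ a c : ℝ) : ℝ :=
  2 * a ^ 2 * logAccel b ε ρ * (polarRadius b ε ρ - q * Real.cos (γ * Θ)) +
    2 * a ^ 2 * logSpeed b ε ρ ^ 2 +
    4 * a * c * γ * q * logSpeed b ε ρ * Real.sin (γ * Θ) +
    2 * c ^ 2 * γ ^ 2 * q * polarRadius b ε ρ * Real.cos (γ * Θ)

variable {γ q Θ a c : ℝ}

theorem hasDerivAt_coneBranch (hb : 0 < b) (hρ : 0 < ρ) (t : ℝ) :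
    HasDerivAt (coneBranch b ε γ ρ q Θ a c) (coneBranchDeriv b ε γ ρ q Θ a c t) t := by
  have h1 := hasDerivAt_polarRadius_exp (ε := ε) hb hρ a t
  have h2 : HasDerivAt (fun t : ℝ => γ * (Θ + t * c)) (γ * c) t := by
    simpa using (((hasDerivAt_id t).mul_const c).const_add Θ).const_mul γ
  have h3 := (((h1.fun_pow 2).add_const (q ^ 2)).fun_sub
    (((h1.const_mul 2).mul_const q).fun_mul h2.cos))
  refine h3.congr_deriv ?_
  simp only [coneBranchDeriv]
  push_cast
  ring

theorem hasDerivAt_coneBranchDeriv (hb : 0 < b) (hρ : 0 < ρ) :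
    HasDerivAt (coneBranchDeriv b ε γ ρ q Θ a c) (coneBranchDeriv₂ b ε γ ρ q Θ a c) 0 := by
  have h1 := hasDerivAt_polarRadius_exp (ε := ε) hb hρ a 0
  have h2 : HasDerivAt (fun t : ℝ => γ * (Θ + t * c)) (γ * c) 0 := by
    simpa using (((hasDerivAt_id (0 : ℝ)).mul_const c).const_add Θ).const_mul γ
  have h4 := hasDerivAt_logSpeed_exp (b := b) (ε := ε) hρ a
  have h5 := ((h4.const_mul (2 * a)).fun_mul (h1.fun_sub (h2.cos.const_mul q))).fun_add
    ((h1.const_mul (2 * c * γ * q)).fun_mul h2.sin)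
  refine h5.congr_deriv ?_
  simp only [coneBranchDeriv₂, zero_mul, Real.exp_zero, mul_one, add_zero]
  ring

/-- The Laplacian of the squared cone distance is bounded above, because the slower angular speed
`γ ≤ b` makes the singular first order terms nonpositive. -/
theorem coneBranchDeriv₂_add_le (hb : 0 < b) (hb1 : b ≤ 1) (hρ : 0 < ρ) (hγ : 0 < γ)
    (hγb : γ ≤ b) (hq : 0 ≤ q) (hcos : 0 ≤ Real.cos (γ * Θ)) :
    coneBranchDeriv₂ b ε γ ρ q Θ a c + coneBranchDeriv₂ b ε γ ρ q Θ (-c) a ≤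
      (a ^ 2 + c ^ 2) * ((2 + 2 / γ) * logSpeed b ε ρ ^ 2) := by
  have hB := logSpeed_pos (ε := ε) hb hρ
  obtain ⟨hD1, hD2⟩ := logAccel_mem_Icc (ε := ε) hb hb1 hρ
  have hs1 : b * polarRadius b ε ρ ≤ logSpeed b ε ρ := mul_polarRadius_le hb hb1 hρ
  have hs := polarRadius_pos (ε := ε) hb hb1 hρ
  set B := logSpeed b ε ρ
  set D := logAccel b ε ρ
  set s := polarRadius b ε ρ
  have e : coneBranchDeriv₂ b ε γ ρ q Θ a c + coneBranchDeriv₂ b ε γ ρ q Θ (-c) a =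
      (a ^ 2 + c ^ 2) * (2 * B ^ 2 + 2 * D * s - 2 * (q * Real.cos (γ * Θ)) * (D - γ ^ 2 * s)) := by
    simp only [coneBranchDeriv₂]
    ring
  rw [e]
  refine mul_le_mul_of_nonneg_left ?_ (by positivity)
  have h1 : γ ^ 2 * s ≤ D := by
    calc γ ^ 2 * s = γ * (γ * s) := by ring
      _ ≤ b * (b * s) := by gcongr
      _ ≤ b * B := by gcongr
      _ ≤ D := hD1
  have h2 : D * s ≤ B ^ 2 / γ := by
    rw [le_div_iff₀ hγ]
    calc D * s * γ = D * (γ * s) := by ring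
      _ ≤ B * (b * s) := by gcongr
      _ ≤ B * B := by gcongr
      _ = B ^ 2 := by ring
  have h3 : 0 ≤ 2 * (q * Real.cos (γ * Θ)) * (D - γ ^ 2 * s) := by
    have := sub_nonneg.2 h1
    positivity
  have h4 : (2 + 2 / γ) * B ^ 2 = 2 * B ^ 2 + 2 * (B ^ 2 / γ) := by ring
  rw [h4]
  linarith

/-- The gradient of the squared cone distance at the base point, in the coordinate `log z`, as
the complex number `F_x - √-1 F_y`. -/
def coneGrad (b ε γ ρ q Θ : ℝ) : ℂ :=
  ⟨2 * logSpeed b ε ρ * (polarRadius b ε ρ - q * Real.cos (γ * Θ)),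
    -(2 * γ * q * polarRadius b ε ρ * Real.sin (γ * Θ))⟩

theorem coneBranchDeriv_zero (ζ : ℂ) :
    coneBranchDeriv b ε γ ρ q Θ ζ.re ζ.im 0 = (coneGrad b ε γ ρ q Θ * ζ).re := by
  simp only [coneBranchDeriv, coneGrad, Complex.mul_re, zero_mul, Real.exp_zero, mul_one, add_zero]
  ring

theorem le_norm_coneGrad_sq (hb : 0 < b) (hb1 : b ≤ 1) (hρ : 0 < ρ) (hγ : 0 < γ) (hγ1 : γ ≤ 1) :
    4 * γ ^ 2 * coneBranch b ε γ ρ q Θ a c 0 * logSpeed b ε ρ ^ 2 ≤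
      ‖coneGrad b ε γ ρ q Θ‖ ^ 2 := by
  have hB := logSpeed_pos (ε := ε) hb hρ
  have hs : logSpeed b ε ρ ≤ polarRadius b ε ρ := mul_polarSpeed_le_polarRadius hb hb1 hρ
  rw [← Complex.normSq_eq_norm_sq, Complex.normSq_apply]
  simp only [coneBranch, coneGrad, zero_mul, Real.exp_zero, mul_one, add_zero]
  set B := logSpeed b ε ρ
  set s := polarRadius b ε ρ
  set C := Real.cos (γ * Θ)
  set S := Real.sin (γ * Θ)
  have hCS : S ^ 2 + C ^ 2 = 1 := Real.sin_sq_add_cos_sq _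
  have e : s ^ 2 + q ^ 2 - 2 * s * q * C = (s - q * C) ^ 2 + q ^ 2 * S ^ 2 := by
    linear_combination -q ^ 2 * hCS
  rw [e]
  have h1 : γ ^ 2 * ((s - q * C) ^ 2 * B ^ 2) ≤ (s - q * C) ^ 2 * B ^ 2 :=
    mul_le_of_le_one_left (by positivity) (by nlinarith)
  have h2 : γ ^ 2 * (q ^ 2 * S ^ 2) * B ^ 2 ≤ γ ^ 2 * (q ^ 2 * S ^ 2) * s ^ 2 := by gcongr
  nlinarith

end ConeBranch

/-! ### Quadratic forms of inverse matrices -/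

section Matrices

open Matrix

variable {ι : Type*} [Fintype ι] [DecidableEq ι] {G B : Matrix ι ι ℂ} {m : ι → ℝ} {K : ℝ}

theorem star_dotProduct_diagonal_mulVec (m : ι → ℝ) (x : ι → ℂ) :
    star x ⬝ᵥ (diagonal (fun j => (m j : ℂ)) *ᵥ x) = ((∑ j, m j * ‖x j‖ ^ 2 : ℝ) : ℂ) := by
  simp only [dotProduct, mulVec_diagonal, Pi.star_apply]
  push_cast
  refine Finset.sum_congr rfl fun j _ => ?_
  have h := Complex.conj_mul' (x j)
  rw [← h]
  simp only [RCLike.star_def]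
  ring

theorem le_star_dotProduct_of_posSemidef_sub
    (h : (G - ((K⁻¹ : ℝ) : ℂ) • diagonal fun j => (m j : ℂ)).PosSemidef) (x : ι → ℂ) :
    K⁻¹ * ∑ j, m j * ‖x j‖ ^ 2 ≤ (star x ⬝ᵥ (G *ᵥ x)).re := by
  have := (Complex.nonneg_iff.1 (h.dotProduct_mulVec_nonneg x)).1
  rw [sub_mulVec, smul_mulVec, dotProduct_sub, dotProduct_smul, star_dotProduct_diagonal_mulVec,
    Complex.sub_re, smul_eq_mul, ← Complex.ofReal_mul, Complex.ofReal_re] at this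
  linarith

theorem star_dotProduct_le_of_posSemidef_sub
    (h : ((K : ℂ) • (diagonal fun j => (m j : ℂ)) - G).PosSemidef) (x : ι → ℂ) :
    (star x ⬝ᵥ (G *ᵥ x)).re ≤ K * ∑ j, m j * ‖x j‖ ^ 2 := by
  have := (Complex.nonneg_iff.1 (h.dotProduct_mulVec_nonneg x)).1
  rw [sub_mulVec, smul_mulVec, dotProduct_sub, dotProduct_smul, star_dotProduct_diagonal_mulVec,
    Complex.sub_re, smul_eq_mul, ← Complex.ofReal_mul, Complex.ofReal_re] at this
  linarith

/-- If `G⁻¹ = Bᴴ B` and `x` is the vector with `G x = e_j`, then `xᴴ G x = x_j` is the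
diagonal entry of `G⁻¹`, which a lower bound on `G` bounds from above. -/
theorem mul_sum_norm_sq_le (hG : G.PosDef) (hB : G⁻¹ = Bᴴ * B) (hm : ∀ j, 0 < m j) (hK : 0 < K)
    (h : (G - ((K⁻¹ : ℝ) : ℂ) • diagonal fun j => (m j : ℂ)).PosSemidef) (j : ι) :
    m j * ∑ a, ‖B a j‖ ^ 2 ≤ K := by
  have hu : IsUnit G.det := (Matrix.isUnit_iff_isUnit_det _).1 hG.isUnit
  set S := ∑ a, ‖B a j‖ ^ 2 with hS
  have hS0 : 0 ≤ S := by positivity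
  have hjj : G⁻¹ j j = (S : ℂ) := by
    rw [hB, mul_apply, hS]
    push_cast
    refine Finset.sum_congr rfl fun a _ => ?_
    rw [conjTranspose_apply, ← Complex.conj_mul', RCLike.star_def]
  set x : ι → ℂ := G⁻¹ *ᵥ Pi.single j 1 with hx
  have hxj : x j = S := by rw [hx, mulVec_single_one, ← hjj]; rfl
  have h1 := le_star_dotProduct_of_posSemidef_sub h x
  have h2 : G *ᵥ x = Pi.single j 1 := by
    rw [hx, mulVec_mulVec, mul_nonsing_inv _ hu, one_mulVec]
  rw [h2, dotProduct_single_one, Pi.star_apply, hxj] at h1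
  have h3 : m j * ‖x j‖ ^ 2 ≤ ∑ j, m j * ‖x j‖ ^ 2 :=
    Finset.single_le_sum (f := fun j => m j * ‖x j‖ ^ 2)
      (fun i _ => mul_nonneg (hm i).le (by positivity)) (Finset.mem_univ j)
  rw [hxj, Complex.norm_real, Real.norm_of_nonneg hS0] at h3
  have h4 : K⁻¹ * (m j * S ^ 2) ≤ S := by
    refine (mul_le_mul_of_nonneg_left h3 (inv_nonneg.2 hK.le)).trans (h1.trans_eq ?_)
    simp
  rw [inv_mul_le_iff₀ hK] at h4
  rcases hS0.eq_or_lt with h0 | h0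
  · rw [← h0]; simpa using hK.le
  · refine le_of_mul_le_mul_right ?_ h0
    linarith

/-- An upper bound on `G` bounds the quadratic form of `G⁻¹ = Bᴴ B` from below. -/
theorem sum_norm_sq_div_le (hG : G.PosDef) (hB : G⁻¹ = Bᴴ * B) (hm : ∀ j, 0 < m j) (hK : 0 < K)
    (h : ((K : ℂ) • (diagonal fun j => (m j : ℂ)) - G).PosSemidef) (x : ι → ℂ) :
    ∑ j, ‖x j‖ ^ 2 / m j ≤ K * ∑ a, ‖∑ j, x j * B a j‖ ^ 2 := by
  have hu : IsUnit G.det := (Matrix.isUnit_iff_isUnit_det _).1 hG.isUnit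
  set p : ι → ℂ := G⁻¹ *ᵥ x with hp
  set y : ι → ℂ := fun j => x j / (m j : ℂ) with hy
  set S := ∑ j, ‖x j‖ ^ 2 / m j with hS
  have hGp : G *ᵥ p = x := by rw [hp, mulVec_mulVec, mul_nonsing_inv _ hu, one_mulVec]
  have hyx : star y ⬝ᵥ x = (S : ℂ) := by
    rw [hS, dotProduct]
    push_cast
    refine Finset.sum_congr rfl fun j _ => ?_
    rw [← Complex.conj_mul', Pi.star_apply, hy, RCLike.star_def, map_div₀, Complex.conj_ofReal]
    ring
  have hyy : ∑ j, m j * ‖y j‖ ^ 2 = S := by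
    refine Finset.sum_congr rfl fun j _ => ?_
    have := (hm j).ne'
    rw [hy]
    simp only [norm_div, Complex.norm_real, Real.norm_of_nonneg (hm j).le]
    field_simp
  have hpy : (star p ⬝ᵥ (G *ᵥ y)) = S := by
    rw [dotProduct_mulVec, ← hG.isHermitian, ← star_mulVec, hGp, star_dotProduct, hyx]
    simp
  have hpx : (star p ⬝ᵥ x).re = ∑ a, ‖∑ j, x j * B a j‖ ^ 2 := by
    have e : star p ⬝ᵥ x = star (B *ᵥ x) ⬝ᵥ (B *ᵥ x) := by
      rw [hp, star_mulVec, ← dotProduct_mulVec, hG.inv.isHermitian, hB, ← mulVec_mulVec,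
        dotProduct_mulVec, star_mulVec]
    rw [e, dotProduct, Complex.re_sum]
    refine Finset.sum_congr rfl fun a _ => ?_
    rw [Pi.star_apply, RCLike.star_def, Complex.conj_mul', ← Complex.ofReal_pow,
      Complex.ofReal_re]
    congr 2
    exact Finset.sum_congr rfl fun j _ => mul_comm _ _
  -- expand `0 ≤ (p - K⁻¹ y)ᴴ G (p - K⁻¹ y)`
  have h0 := (Complex.nonneg_iff.1 (hG.posSemidef.dotProduct_mulVec_nonneg
    (p - ((K⁻¹ : ℝ) : ℂ) • y))).1
  have h1 := star_dotProduct_le_of_posSemidef_sub h y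
  rw [hyy] at h1
  simp only [star_sub, star_smul, mulVec_sub, mulVec_smul, sub_dotProduct, dotProduct_sub,
    smul_dotProduct, dotProduct_smul, hGp, hyx, hpy, Complex.sub_re, smul_eq_mul,
    RCLike.star_def, Complex.conj_ofReal, Complex.re_ofReal_mul, Complex.ofReal_re, hpx] at h0
  have h2 : K⁻¹ * (star y ⬝ᵥ G *ᵥ y).re ≤ S := by
    rwa [inv_mul_le_iff₀ hK]
  have h3 : K⁻¹ * (K⁻¹ * (star y ⬝ᵥ G *ᵥ y).re) ≤ K⁻¹ * S := by gcongr
  have h4 : K⁻¹ * S ≤ ∑ a, ‖∑ j, x j * B a j‖ ^ 2 := by linarith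
  rwa [inv_mul_le_iff₀ hK] at h4

end Matrices

/-! ### The Laplacian as a sum over complex directions -/

section Hessian

variable {n : ℕ}

theorem eq_sum_single (w : Space n) : w = ∑ i, ((w i).re • EuclideanSpace.single i (1 : ℂ) +
    (w i).im • EuclideanSpace.single i Complex.I) := by
  ext j
  simp only [WithLp.ofLp_sum, WithLp.ofLp_add, WithLp.ofLp_smul, Finset.sum_apply, Pi.add_apply,
    Pi.smul_apply, PiLp.single_apply, smul_ite, smul_zero]
  rw [Finset.sum_add_distrib]
  simp [Finset.sum_ite_eq]

theorem bilin_apply_eq_sum (H : Space n →L[ℝ] Space n →L[ℝ] ℝ) (v w : Space n) :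
    H v w = ∑ i, ∑ j,
      ((v i).re * (w j).re * H (EuclideanSpace.single i 1) (EuclideanSpace.single j 1) +
      (v i).re * (w j).im * H (EuclideanSpace.single i 1) (EuclideanSpace.single j Complex.I) +
      (v i).im * (w j).re * H (EuclideanSpace.single i Complex.I) (EuclideanSpace.single j 1) +
      (v i).im * (w j).im *
        H (EuclideanSpace.single i Complex.I) (EuclideanSpace.single j Complex.I)) := by
  conv_lhs => rw [eq_sum_single v, eq_sum_single w]
  simp only [map_sum, map_add, map_smul, sum_apply,
    add_apply, smul_apply, smul_eq_mul]
  rw [Finset.sum_comm]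
  refine Finset.sum_congr rfl fun i _ => ?_
  rw [Finset.mul_sum, Finset.mul_sum, ← Finset.sum_add_distrib]
  refine Finset.sum_congr rfl fun j _ => ?_
  ring

/-- The complex Hessian in the direction `w` is the Laplacian on the complex line through `w`. -/
theorem re_sum_complexHessian (f : Space n → ℝ) (z w : Space n) :
    4 * (∑ i, ∑ j, w i * complexHessian f z i j * star (w j)).re =
      fderiv ℝ (fderiv ℝ f) z w w +
        fderiv ℝ (fderiv ℝ f) z (Complex.I • w) (Complex.I • w) := by
  rw [bilin_apply_eq_sum _ w, bilin_apply_eq_sum _ (Complex.I • w), Complex.re_sum,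
    Finset.mul_sum, ← Finset.sum_add_distrib]
  refine Finset.sum_congr rfl fun i _ => ?_
  rw [Complex.re_sum, Finset.mul_sum, ← Finset.sum_add_distrib]
  refine Finset.sum_congr rfl fun j _ => ?_
  simp only [complexHessian, Matrix.of_apply, iteratedFDeriv_two_apply, Matrix.cons_val_zero,
    Matrix.cons_val_one, PiLp.smul_apply, smul_eq_mul]
  have e : ∀ x y : ℝ, ((x : ℂ) + Complex.I * (y : ℂ)) / 4 = ⟨x / 4, y / 4⟩ := fun x y => by
    apply Complex.ext <;> simp
  rw [e]
  simp only [Complex.mul_re, Complex.mul_im, RCLike.star_def, Complex.conj_re, Complex.conj_im,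
    Complex.I_re, Complex.I_im]
  ring

theorem laplacian_eq_sum {G B : Matrix (Fin n) (Fin n) ℂ} (hB : G⁻¹ = B.conjTranspose * B)
    (f : Space n → ℝ) (z : Space n) :
    laplacian G f z = ∑ a, (fderiv ℝ (fderiv ℝ f) z (WithLp.toLp 2 (B a)) (WithLp.toLp 2 (B a)) +
      fderiv ℝ (fderiv ℝ f) z (Complex.I • WithLp.toLp 2 (B a))
        (Complex.I • WithLp.toLp 2 (B a))) := by
  simp only [← re_sum_complexHessian]
  rw [← Finset.mul_sum, ← Complex.re_sum, laplacian, hB, Matrix.mul_assoc, Matrix.trace_mul_comm]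
  congr 2
  simp only [Matrix.trace, Matrix.diag, Matrix.mul_apply, Matrix.conjTranspose_apply,
    Finset.sum_mul]
  refine Finset.sum_congr rfl fun a _ => ?_
  rw [Finset.sum_comm]

end Hessian

/-! ### The second derivative test along logarithmic curves -/

section SecondDerivative

theorem second_deriv_nonpos_of_isLocalMax {h h' : ℝ → ℝ} {h'' x : ℝ}
    (hd : ∀ᶠ t in 𝓝 x, HasDerivAt h (h' t) t) (hd' : HasDerivAt h' h'' x)
    (hmax : IsLocalMax h x) : h'' ≤ 0 := by
  by_contra! hpos
  have e : deriv h =ᶠ[𝓝 x] h' := hd.mono fun t ht => ht.deriv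
  have e2 : deriv (deriv h) x = h'' := by rw [e.deriv_eq, hd'.deriv]
  have hmin := isLocalMin_of_deriv_deriv_pos (by rwa [e2]) hmax.deriv_eq_zero
    hd.self_of_nhds.continuousAt
  have hc : h =ᶠ[𝓝 x] fun _ => h x := by
    filter_upwards [hmin, hmax] with t h1 h2 using le_antisymm h2 h1
  have h0 : deriv (deriv h) x = 0 := by
    rw [hc.deriv.deriv_eq]
    simp
  linarith

variable {n : ℕ}

/-- The curve through `z` whose logarithm moves with the constant velocity `ζ`. -/
def logCurve (z ζ : Space n) (t : ℝ) : Space n :=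
  WithLp.toLp 2 fun j => z j * Complex.exp (t * ζ j)

/-- The velocity of `logCurve`. -/
def logCurveDeriv (z ζ : Space n) (t : ℝ) : Space n :=
  WithLp.toLp 2 fun j => z j * ζ j * Complex.exp (t * ζ j)

@[simp]
theorem logCurve_zero (z ζ : Space n) : logCurve z ζ 0 = z := by
  ext j; simp [logCurve]

theorem hasDerivAt_logCurve (z ζ : Space n) (t : ℝ) :
    HasDerivAt (logCurve z ζ) (logCurveDeriv z ζ t) t := by
  have h0 : HasDerivAt (fun (t : ℝ) (j : Fin n) => z j * Complex.exp (t * ζ j))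
      (fun j => z j * ζ j * Complex.exp (t * ζ j)) t := by
    rw [hasDerivAt_pi]
    intro j
    have h : HasDerivAt (fun t : ℝ => (t : ℂ) * ζ j) (ζ j) t := by
      simpa using (Complex.ofRealCLM.hasDerivAt (x := t)).mul_const (ζ j)
    refine (h.cexp.const_mul (z j)).congr_deriv ?_
    ring
  exact (PiLp.hasFDerivAt_toLp (𝕜 := ℝ) 2 _).comp_hasDerivAt t h0

theorem hasDerivAt_logCurveDeriv (z ζ : Space n) :
    HasDerivAt (logCurveDeriv z ζ) (WithLp.toLp 2 fun j => z j * ζ j ^ 2) 0 := by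
  have h := hasDerivAt_logCurve (WithLp.toLp 2 fun j => z j * ζ j) ζ 0
  refine h.congr_deriv ?_
  ext j
  simp only [logCurveDeriv, Complex.ofReal_zero, zero_mul, Complex.exp_zero, mul_one]
  ring

theorem eventually_hasDerivAt_comp_logCurve {u : Space n → ℝ} {z : Space n}
    (hu : ContDiffAt ℝ 2 u z) (ζ : Space n) :
    ∀ᶠ t in 𝓝 (0 : ℝ), HasDerivAt (fun t => u (logCurve z ζ t))
      (fderiv ℝ u (logCurve z ζ t) (logCurveDeriv z ζ t)) t := by
  have h1 : ∀ᶠ x in 𝓝 z, DifferentiableAt ℝ u x :=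
    (hu.eventually (by simp)).mono fun x hx => hx.differentiableAt (by simp)
  have h2 : Filter.Tendsto (logCurve z ζ) (𝓝 0) (𝓝 z) := by
    simpa [ContinuousAt] using (hasDerivAt_logCurve z ζ 0).continuousAt
  filter_upwards [h2.eventually h1] with t ht
  exact ht.hasFDerivAt.comp_hasDerivAt t (hasDerivAt_logCurve z ζ t)

theorem hasDerivAt_fderiv_logCurve {u : Space n → ℝ} {z : Space n}
    (hu : ContDiffAt ℝ 2 u z) (ζ : Space n) :
    HasDerivAt (fun t => fderiv ℝ u (logCurve z ζ t) (logCurveDeriv z ζ t))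
      (fderiv ℝ (fderiv ℝ u) z (WithLp.toLp 2 fun j => z j * ζ j)
        (WithLp.toLp 2 fun j => z j * ζ j) +
        fderiv ℝ u z (WithLp.toLp 2 fun j => z j * ζ j ^ 2)) 0 := by
  have h1 : DifferentiableAt ℝ (fderiv ℝ u) (logCurve z ζ 0) := by
    rw [logCurve_zero]
    exact (hu.fderiv_right (m := 1) (by norm_num)).differentiableAt (by simp)
  have h2 := h1.hasFDerivAt.comp_hasDerivAt 0 (hasDerivAt_logCurve z ζ 0)
  have h3 := h2.clm_apply (hasDerivAt_logCurveDeriv z ζ)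
  have e : logCurveDeriv z ζ 0 = WithLp.toLp 2 fun j => z j * ζ j := by
    ext j; simp [logCurveDeriv]
  simp only [Function.comp_apply, logCurve_zero, e] at h3
  exact h3

end SecondDerivative

/-! ### The barrier at an interior maximum -/

section Barrier

/-- The polar coordinate of a single holomorphic coordinate. -/
def polarMap (b ε : ℝ) (z : ℂ) : ℂ := ((polarRadius b ε ‖z‖ / ‖z‖ : ℝ) : ℂ) * z

theorem norm_polarMap {b ε : ℝ} {z : ℂ} (hb : 0 < b) (hz : z ≠ 0) :
    ‖polarMap b ε z‖ = polarRadius b ε ‖z‖ := by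
  have h := norm_pos_iff.2 hz
  rw [polarMap, norm_mul, Complex.norm_real, Real.norm_of_nonneg
    (div_nonneg (polarRadius_nonneg hb h.le) h.le), div_mul_cancel₀ _ h.ne']

theorem continuousAt_polarMap {b ε : ℝ} {z : ℂ} (hb : 0 < b) (hz : z ≠ 0) :
    ContinuousAt (polarMap b ε) z := by
  have h := norm_pos_iff.2 hz
  have h1 : ContinuousAt (fun z : ℂ => polarRadius b ε ‖z‖) z :=
    ContinuousAt.comp (g := polarRadius b ε) (hasDerivAt_polarRadius hb h).continuousAt
      continuous_norm.continuousAt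
  unfold polarMap
  exact (Complex.continuous_ofReal.continuousAt.comp
    (h1.div continuous_norm.continuousAt h.ne')).mul continuousAt_id

/-- Along every logarithmic curve through a point with `z ≠ 0` the squared cone distance is touched
from above by a branch, with an angle `Θ` that does not depend on the curve. -/
theorem exists_coneBranch {b ε γ : ℝ} (hb : 0 < b) (hb1 : b ≤ 1) (hγ : 0 ≤ γ) (hγ1 : γ ≤ 1 / 2)
    {z : ℂ} (hz : z ≠ 0) (w : ℂ) :
    ∃ Θ : ℝ, 0 ≤ Real.cos (γ * Θ) ∧
      (∀ a c, coneBranch b ε γ ‖z‖ ‖w‖ Θ a c 0 = coneDist γ (polarMap b ε z) w ^ 2) ∧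
      ∀ ζ : ℂ, ∀ᶠ t : ℝ in 𝓝 0, coneDist γ (polarMap b ε (z * Complex.exp (t * ζ))) w ^ 2 ≤
        coneBranch b ε γ ‖z‖ ‖w‖ Θ ζ.re ζ.im t := by
  have hz0 := norm_pos_iff.2 hz
  have hs : 0 < polarRadius b ε ‖z‖ := polarRadius_pos hb hb1 hz0
  have hξ : polarMap b ε z ≠ 0 := norm_pos_iff.1 (by rwa [norm_polarMap hb hz])
  obtain ⟨Θ, hΘ, h0, h1⟩ := exists_angle_coneDist_sq_le hγ hγ1 hξ w
  refine ⟨Θ, ?_, fun a c => ?_, fun ζ => ?_⟩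
  · rw [← Real.cos_abs, abs_mul, abs_of_nonneg hγ]
    refine Real.cos_nonneg_of_neg_pi_div_two_le_of_le ?_ ?_ <;>
      nlinarith [abs_nonneg Θ, Real.pi_pos]
  · rw [h0, norm_polarMap hb hz]
    simp [coneBranch]
  · have hy : ∀ᶠ t : ℝ in 𝓝 0, |t * ζ.im| ≤ Real.pi := by
      have hc : Filter.Tendsto (fun t : ℝ => |t * ζ.im|) (𝓝 0) (𝓝 0) := by
        have : Continuous fun t : ℝ => |t * ζ.im| := by fun_prop
        simpa using this.tendsto 0
      exact (hc.eventually (gt_mem_nhds Real.pi_pos)).mono fun t ht => ht.le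
    filter_upwards [hy] with t ht
    set ρ := ‖z‖ * Real.exp (t * ζ.re) with hρ
    have hρ0 : 0 < ρ := by positivity
    have hn : ‖z * Complex.exp (t * ζ)‖ = ρ := by
      rw [norm_mul, Complex.norm_exp, Complex.re_ofReal_mul]
    have hs1 := polarRadius_pos (ε := ε) hb hb1 hρ0
    have h2 := h1 (t * ζ.im) (polarRadius b ε ρ / polarRadius b ε ‖z‖) ht (by positivity)
    rw [norm_polarMap hb hz, div_mul_cancel₀ _ hs.ne'] at h2
    have e : ((polarRadius b ε ρ / polarRadius b ε ‖z‖ : ℝ) : ℂ) *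
        Complex.exp ((t * ζ.im : ℝ) * Complex.I) * polarMap b ε z =
        polarMap b ε (z * Complex.exp (t * ζ)) := by
      have e1 : Complex.exp (t * ζ) =
          (Real.exp (t * ζ.re) : ℂ) * Complex.exp ((t * ζ.im : ℝ) * Complex.I) := by
        rw [Complex.ofReal_exp, ← Complex.exp_add]
        congr 1
        conv_lhs => rw [← Complex.re_add_im ζ]
        push_cast
        ring
      have hs' : (polarRadius b ε ‖z‖ : ℂ) ≠ 0 := by exact_mod_cast hs.ne'
      have hz' : (‖z‖ : ℂ) ≠ 0 := by exact_mod_cast hz0.ne'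
      have he' : (Real.exp (t * ζ.re) : ℂ) ≠ 0 := by exact_mod_cast (Real.exp_pos _).ne'
      rw [polarMap, polarMap, hn, e1, Complex.ofReal_div, Complex.ofReal_div, Complex.ofReal_div,
        hρ, Complex.ofReal_mul ‖z‖]
      field_simp
    rw [e] at h2
    exact h2

variable {n : ℕ}

/-- The function `R² - ∑ d(ξ_j, y_j)²`, where `d` is the distance in the cone of angle `2πγ`, in the
holomorphic coordinates `z`. The barrier is a decaying multiple of its square. -/
def coneGap (b : Fin n → ℝ) (ε γ R : ℝ) (y z : Space n) : ℝ :=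
  R ^ 2 - ∑ j, coneDist γ (polarMap (b j) ε (z j)) (y j) ^ 2

variable {b : Fin n → ℝ} {ε γ R : ℝ} {y z : Space n}

/-- The second derivative test along a logarithmic curve, on which the barrier is replaced by
a smooth minorant and `log |z_j|` is affine. -/
theorem second_deriv_add_barrier_nonpos (hb : ∀ j, 0 < b j)
    (hz : ∀ j, z j ≠ 0) {u : Space n → ℝ} (hu : ContDiffAt ℝ 2 u z) {N δ : ℝ} (hN : 0 ≤ N)
    (hρ : 0 < coneGap b ε γ R y z)
    (hmax : IsLocalMax
      (fun x => u x + N * coneGap b ε γ R y x ^ 2 + δ * ∑ j, Real.log ‖x j‖) z)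
    {Θ : Fin n → ℝ}
    (h0 : ∀ j a c, coneBranch (b j) ε γ ‖z j‖ ‖y j‖ (Θ j) a c 0 =
      coneDist γ (polarMap (b j) ε (z j)) (y j) ^ 2)
    (h1 : ∀ j, ∀ ζ : ℂ, ∀ᶠ t : ℝ in 𝓝 0,
      coneDist γ (polarMap (b j) ε (z j * Complex.exp (t * ζ))) (y j) ^ 2 ≤
        coneBranch (b j) ε γ ‖z j‖ ‖y j‖ (Θ j) ζ.re ζ.im t)
    (ζ : Space n) :
    fderiv ℝ (fderiv ℝ u) z (WithLp.toLp 2 fun j => z j * ζ j)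
        (WithLp.toLp 2 fun j => z j * ζ j) +
      fderiv ℝ u z (WithLp.toLp 2 fun j => z j * ζ j ^ 2) +
      N * (2 * (∑ j, coneGrad (b j) ε γ ‖z j‖ ‖y j‖ (Θ j) * ζ j).re ^ 2 -
        2 * coneGap b ε γ R y z *
          ∑ j, coneBranchDeriv₂ (b j) ε γ ‖z j‖ ‖y j‖ (Θ j) (ζ j).re (ζ j).im) ≤ 0 := by
  have hz0 : ∀ j, 0 < ‖z j‖ := fun j => norm_pos_iff.2 (hz j)
  set F : ℝ → ℝ := fun t =>
    R ^ 2 - ∑ j, coneBranch (b j) ε γ ‖z j‖ ‖y j‖ (Θ j) (ζ j).re (ζ j).im t with hF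
  set F' : ℝ → ℝ := fun t =>
    -∑ j, coneBranchDeriv (b j) ε γ ‖z j‖ ‖y j‖ (Θ j) (ζ j).re (ζ j).im t with hF'
  have hF0 : F 0 = coneGap b ε γ R y z := by simp only [hF, h0, coneGap]
  have hFd : ∀ t, HasDerivAt F (F' t) t := fun t =>
    (HasDerivAt.fun_sum fun j _ => hasDerivAt_coneBranch (hb j) (hz0 j) t).const_sub _
  have hFd' : HasDerivAt F'
      (-∑ j, coneBranchDeriv₂ (b j) ε γ ‖z j‖ ‖y j‖ (Θ j) (ζ j).re (ζ j).im) 0 :=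
    (HasDerivAt.fun_sum fun j _ => hasDerivAt_coneBranchDeriv (hb j) (hz0 j)).fun_neg
  have hF'0 : F' 0 = -(∑ j, coneGrad (b j) ε γ ‖z j‖ ‖y j‖ (Θ j) * ζ j).re := by
    simp only [hF', coneBranchDeriv_zero, Complex.re_sum]
  set Λ : ℝ → ℝ := fun t => ∑ j, (Real.log ‖z j‖ + t * (ζ j).re) with hΛ
  have hΛd : ∀ t, HasDerivAt Λ (∑ j, (ζ j).re) t := fun t => by
    refine HasDerivAt.fun_sum fun j _ => ?_
    simpa using ((hasDerivAt_id t).mul_const (ζ j).re).const_add (Real.log ‖z j‖)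
  have hlog : ∀ t : ℝ, ∑ j, Real.log ‖logCurve z ζ t j‖ = Λ t := fun t => by
    refine Finset.sum_congr rfl fun j _ => ?_
    simp only [logCurve, norm_mul, Complex.norm_exp, Complex.re_ofReal_mul]
    rw [Real.log_mul (hz0 j).ne' (Real.exp_pos _).ne', Real.log_exp]
  have hgap : ∀ᶠ t : ℝ in 𝓝 0, F t ≤ coneGap b ε γ R y (logCurve z ζ t) := by
    filter_upwards [Filter.eventually_all.2 fun j => h1 j (ζ j)] with t ht
    simp only [hF, coneGap]
    gcongr with j
    exact ht j
  have hpos : ∀ᶠ t : ℝ in 𝓝 0, 0 ≤ F t :=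
    ((hFd 0).continuousAt.eventually_const_lt (by rwa [hF0])).mono fun t ht => le_of_lt ht
  have hcurve : Filter.Tendsto (logCurve z ζ) (𝓝 0) (𝓝 z) := by
    simpa [ContinuousAt] using (hasDerivAt_logCurve z ζ 0).continuousAt
  have hloc : IsLocalMax (fun t => u (logCurve z ζ t) + N * F t ^ 2 + δ * Λ t) 0 := by
    filter_upwards [hgap, hpos, hcurve.eventually hmax] with t ht1 ht2 ht3
    rw [hlog] at ht3
    have e1 : Λ 0 = ∑ j, Real.log ‖z j‖ := by rw [← hlog, logCurve_zero]
    have e2 : N * F t ^ 2 ≤ N * coneGap b ε γ R y (logCurve z ζ t) ^ 2 := by gcongr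
    simp only [logCurve_zero, hF0, e1]
    linarith
  have hd : ∀ᶠ t : ℝ in 𝓝 0, HasDerivAt
      (fun t => u (logCurve z ζ t) + N * F t ^ 2 + δ * Λ t)
      (fderiv ℝ u (logCurve z ζ t) (logCurveDeriv z ζ t) + N * (2 * F t * F' t) +
        δ * ∑ j, (ζ j).re) t := by
    filter_upwards [eventually_hasDerivAt_comp_logCurve hu ζ] with t ht
    refine ((ht.fun_add (((hFd t).fun_pow 2).const_mul N)).fun_add
      ((hΛd t).const_mul δ)).congr_deriv ?_
    push_cast
    ring
  have hd' := (((hasDerivAt_fderiv_logCurve hu ζ).fun_add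
    (((((hFd 0).const_mul 2).fun_mul hFd').const_mul N)))).add_const (δ * ∑ j, (ζ j).re)
  have := second_deriv_nonpos_of_isLocalMax hd hd' hloc
  rw [hF0, hF'0] at this
  refine (le_of_eq ?_).trans this
  ring

/-- At an interior maximum of the comparison function the Laplacian of `u` is controlled by the
barrier: the gradient term is positive where the gap is small. -/
theorem laplacian_le_of_isLocalMax (hb : ∀ j, 0 < b j) (hb1 : ∀ j, b j ≤ 1) (hγ : 0 < γ)
    (hγ1 : γ ≤ 1 / 2) (hγb : ∀ j, γ ≤ b j) (hz : ∀ j, z j ≠ 0) {G : Matrix (Fin n) (Fin n) ℂ}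
    {K : ℝ} (hK : 0 < K) (hG : G.PosDef)
    (hlow : (G - ((K⁻¹ : ℝ) : ℂ) • Matrix.diagonal fun j =>
      ((polarSpeed (b j) ε ‖z j‖ ^ 2 : ℝ) : ℂ)).PosSemidef)
    (hup : ((K : ℂ) • (Matrix.diagonal fun j =>
      ((polarSpeed (b j) ε ‖z j‖ ^ 2 : ℝ) : ℂ)) - G).PosSemidef)
    {u : Space n → ℝ} (hu : ContDiffAt ℝ 2 u z) {N δ : ℝ} (hN : 0 ≤ N)
    (hρ : 0 < coneGap b ε γ R y z)
    (hmax : IsLocalMax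
      (fun x => u x + N * coneGap b ε γ R y x ^ 2 + δ * ∑ j, Real.log ‖x j‖) z) :
    laplacian G u z ≤ -(N * (8 * γ ^ 2 / K * (R ^ 2 - coneGap b ε γ R y z) -
      2 * coneGap b ε γ R y z * (n * K * (2 + 2 / γ)))) := by
  have hz0 : ∀ j, 0 < ‖z j‖ := fun j => norm_pos_iff.2 (hz j)
  set m : Fin n → ℝ := fun j => polarSpeed (b j) ε ‖z j‖ ^ 2 with hm
  have hm0 : ∀ j, 0 < m j := fun j => pow_pos (polarSpeed_pos (hb j) (hz0 j)) 2
  obtain ⟨B, hB⟩ : ∃ B : Matrix (Fin n) (Fin n) ℂ, G⁻¹ = B.conjTranspose * B := by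
    open scoped MatrixOrder in
    exact CStarAlgebra.nonneg_iff_eq_star_mul_self.1 hG.inv.posSemidef.nonneg
  choose Θ hcos h0 h1 using fun j => exists_coneBranch (ε := ε) (hb j) (hb1 j) hγ.le hγ1 (hz j) (y j)
  set g : Fin n → ℂ := fun j => coneGrad (b j) ε γ ‖z j‖ ‖y j‖ (Θ j) with hg
  set ρ := coneGap b ε γ R y z with hρdef
  have hBm : ∀ j, logSpeed (b j) ε ‖z j‖ ^ 2 = ‖z j‖ ^ 2 * m j := fun j => by
    rw [logSpeed, mul_pow]
  have hdir : ∀ a, fderiv ℝ (fderiv ℝ u) z (WithLp.toLp 2 (B a)) (WithLp.toLp 2 (B a)) +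
      fderiv ℝ (fderiv ℝ u) z (Complex.I • WithLp.toLp 2 (B a))
        (Complex.I • WithLp.toLp 2 (B a)) ≤
      -(N * (2 * ‖∑ j, g j / z j * B a j‖ ^ 2 -
        2 * ρ * ((2 + 2 / γ) * ∑ j, m j * ‖B a j‖ ^ 2))) := by
    intro a
    set ζ : Space n := WithLp.toLp 2 fun j => B a j / z j with hζ
    have e1 : (WithLp.toLp 2 fun j => z j * ζ j : Space n) = WithLp.toLp 2 (B a) := by
      ext j
      simp only [hζ]
      exact mul_div_cancel₀ _ (hz j)
    have e2 : (WithLp.toLp 2 fun j => z j * (Complex.I • ζ) j : Space n) =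
        Complex.I • WithLp.toLp 2 (B a) := by
      rw [← e1]
      ext j
      simp only [PiLp.smul_apply, smul_eq_mul]
      ring
    have e3 : (WithLp.toLp 2 fun j => z j * (Complex.I • ζ) j ^ 2 : Space n) =
        -WithLp.toLp 2 fun j => z j * ζ j ^ 2 := by
      ext j
      simp only [PiLp.smul_apply, PiLp.neg_apply, smul_eq_mul, mul_pow, Complex.I_sq]
      ring
    have k1 := second_deriv_add_barrier_nonpos hb hz hu hN hρ hmax h0 h1 ζ
    have k2 := second_deriv_add_barrier_nonpos hb hz hu hN hρ hmax h0 h1 (Complex.I • ζ)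
    rw [e1] at k1
    rw [e2, e3, map_neg] at k2
    set P := ∑ j, g j * ζ j with hP
    have e4 : ∑ j, g j * (Complex.I • ζ) j = Complex.I * P := by
      rw [hP, Finset.mul_sum]
      refine Finset.sum_congr rfl fun j _ => ?_
      simp only [PiLp.smul_apply, smul_eq_mul]
      ring
    have e5 : P.re ^ 2 + (Complex.I * P).re ^ 2 = ‖∑ j, g j / z j * B a j‖ ^ 2 := by
      have : ∑ j, g j / z j * B a j = P :=
        Finset.sum_congr rfl fun j _ => by simp only [hζ]; ring
      rw [this, ← Complex.normSq_eq_norm_sq, Complex.normSq_apply, Complex.I_mul_re]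
      ring
    have e6 : ∑ j, coneBranchDeriv₂ (b j) ε γ ‖z j‖ ‖y j‖ (Θ j) (ζ j).re (ζ j).im +
        ∑ j, coneBranchDeriv₂ (b j) ε γ ‖z j‖ ‖y j‖ (Θ j) ((Complex.I • ζ) j).re
          ((Complex.I • ζ) j).im ≤ (2 + 2 / γ) * ∑ j, m j * ‖B a j‖ ^ 2 := by
      rw [← Finset.sum_add_distrib, Finset.mul_sum]
      refine Finset.sum_le_sum fun j _ => ?_
      have k3 := coneBranchDeriv₂_add_le (ε := ε) (a := (ζ j).re) (c := (ζ j).im) (hb j) (hb1 j)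
        (hz0 j) hγ (hγb j) (norm_nonneg (y j)) (hcos j)
      simp only [PiLp.smul_apply, smul_eq_mul, Complex.I_mul_re, Complex.I_mul_im]
      refine k3.trans_eq ?_
      have e7 : (ζ j).re ^ 2 + (ζ j).im ^ 2 = ‖B a j‖ ^ 2 / ‖z j‖ ^ 2 := by
        rw [← div_pow, ← norm_div, ← Complex.normSq_eq_norm_sq, Complex.normSq_apply]
        ring
      have := (hz0 j).ne'
      rw [e7, hBm]
      field_simp
    rw [e4] at k2
    have k4 := mul_le_mul_of_nonneg_left e6 (by positivity : 0 ≤ N * (2 * ρ))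
    rw [← e5]
    linarith
  rw [laplacian_eq_sum hB]
  refine (Finset.sum_le_sum fun a _ => hdir a).trans ?_
  rw [Finset.sum_neg_distrib, neg_le_neg_iff, ← Finset.mul_sum]
  refine mul_le_mul_of_nonneg_left ?_ hN
  rw [Finset.sum_sub_distrib, ← Finset.mul_sum, ← Finset.mul_sum, ← Finset.mul_sum]
  have l1 : ∑ a, ∑ j, m j * ‖B a j‖ ^ 2 ≤ n * K := by
    rw [Finset.sum_comm]
    calc _ ≤ ∑ _ : Fin n, K := Finset.sum_le_sum fun j _ => by
          rw [← Finset.mul_sum]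
          exact mul_sum_norm_sq_le hG hB hm0 hK hlow j
      _ = n * K := by simp
  have l2 := sum_norm_sq_div_le hG hB hm0 hK hup fun j => g j / z j
  have l3 : 4 * γ ^ 2 * (R ^ 2 - ρ) ≤ ∑ j, ‖g j / z j‖ ^ 2 / m j := by
    have e : R ^ 2 - ρ = ∑ j, coneDist γ (polarMap (b j) ε (z j)) (y j) ^ 2 := by
      rw [hρdef, coneGap]; ring
    rw [e, Finset.mul_sum]
    refine Finset.sum_le_sum fun j _ => ?_
    have k := le_norm_coneGrad_sq (ε := ε) (q := ‖y j‖) (Θ := Θ j) (a := 0) (c := 0) (hb j) (hb1 j)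
      (hz0 j) hγ (by linarith)
    rw [h0 j, hBm] at k
    rw [norm_div, div_pow, div_div, le_div_iff₀ (mul_pos (pow_pos (hz0 j) 2) (hm0 j))]
    exact k
  have l4 : 8 * γ ^ 2 / K * (R ^ 2 - ρ) ≤ 2 * ∑ a, ‖∑ j, g j / z j * B a j‖ ^ 2 := by
    have e : 8 * γ ^ 2 / K * (R ^ 2 - ρ) = 2 * (4 * γ ^ 2 * (R ^ 2 - ρ)) / K := by ring
    rw [e, div_le_iff₀ hK]
    linarith
  have l5 : 2 * ρ * ((2 + 2 / γ) * ∑ a, ∑ j, m j * ‖B a j‖ ^ 2) ≤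
      2 * ρ * (n * K * (2 + 2 / γ)) := by
    have : (2 + 2 / γ) * ∑ a, ∑ j, m j * ‖B a j‖ ^ 2 ≤ (2 + 2 / γ) * (n * K) := by gcongr
    have := mul_le_mul_of_nonneg_left this (by positivity : 0 ≤ 2 * ρ)
    linarith
  linarith

end Barrier

/-! ### The gap function on a slant cylinder -/

section Gap

variable {n : ℕ}

/-- The cone angle parameters of all coordinates: `1` for those which do not define a component
of the divisor. -/
def ConeData.exponent (c : ConeData n) (j : Fin n) : ℝ := if (j : ℕ) < c.k then c.β j else 1

theorem ConeData.exponent_pos (c : ConeData n) (j : Fin n) : 0 < c.exponent j := by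
  unfold exponent
  split_ifs with h
  · exact c.β_pos j h
  · exact one_pos

theorem ConeData.exponent_le_one (c : ConeData n) (j : Fin n) : c.exponent j ≤ 1 := by
  unfold exponent
  split_ifs with h
  · exact c.β_le_one j h
  · exact le_rfl

theorem ConeData.modelMetric_eq (c : ConeData n) (ε : ℝ) (z : Space n) :
    c.modelMetric ε z =
      Matrix.diagonal fun j => ((polarSpeed (c.exponent j) ε ‖z j‖ ^ 2 : ℝ) : ℂ) := by
  unfold modelMetric
  congr 1
  funext j
  rw [polarSpeed_sq]
  by_cases h : (j : ℕ) < c.k <;> simp [exponent, h]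

theorem polarMap_one (ε : ℝ) (z : ℂ) : polarMap 1 ε z = z := by
  have h : polarRadius 1 ε ‖z‖ = ‖z‖ := by simp [polarRadius]
  rw [polarMap, h]
  rcases eq_or_ne z 0 with rfl | hz
  · simp
  · rw [div_self (norm_ne_zero_iff.2 hz)]
    simp

theorem ConeData.polar_apply (c : ConeData n) (ε : ℝ) (z : Space n) (j : Fin n) :
    c.polar ε z j = polarMap (c.exponent j) ε (z j) := by
  by_cases h : (j : ℕ) < c.k
  · simp [polar, exponent, h, polarMap]
  · simp [polar, exponent, h, polarMap_one]

theorem ConeData.continuousAt_polarMap {c : ConeData n} {z : Space n} (hz : z ∉ c.divisor) (ε : ℝ)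
    (j : Fin n) : ContinuousAt (polarMap (c.exponent j) ε) (z j) := by
  by_cases h : (j : ℕ) < c.k
  · exact Conic.continuousAt_polarMap (c.exponent_pos j) fun h0 => hz ⟨j, h, h0⟩
  · have : polarMap (c.exponent j) ε = id := by
      funext x
      simp [exponent, h, polarMap_one]
    rw [this]
    exact continuousAt_id

theorem ConeData.not_mem_divisor (c : ConeData n) {z : Space n} (hz : ∀ j, z j ≠ 0) :
    z ∉ c.divisor := fun ⟨j, _, h⟩ => hz j h

theorem ConeData.continuousAt_coneGap (c : ConeData n) {γ : ℝ} (hγ : 0 ≤ γ) (hγ1 : γ ≤ 1)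
    (ε R : ℝ) {α : Type*} [TopologicalSpace α] {a : α} {y z : α → Space n} (ha : z a ∉ c.divisor)
    (hy : ContinuousAt y a) (hz : ContinuousAt z a) :
    ContinuousAt (fun x => coneGap c.exponent ε γ R (y x) (z x)) a := by
  unfold coneGap
  refine continuousAt_const.sub (tendsto_finsetSum _ fun j _ => ?_)
  have h1 : ContinuousAt (fun x => polarMap (c.exponent j) ε (z x j)) a :=
    ContinuousAt.comp (f := fun x => z x j) (c.continuousAt_polarMap ha ε j) (by fun_prop)
  have h2 : ContinuousAt (fun x => y x j) a := by fun_prop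
  exact ((continuous_coneDist hγ hγ1).continuousAt.comp (h1.prodMk h2)).pow 2

theorem coneGap_le {b : Fin n → ℝ} {ε γ R : ℝ} {y z : Space n} : coneGap b ε γ R y z ≤ R ^ 2 :=
  sub_le_self _ (Finset.sum_nonneg fun _ _ => sq_nonneg _)

theorem ConeData.mul_norm_polar_sub_le (c : ConeData n) {ε γ R : ℝ} {y z : Space n} (hγ : 0 ≤ γ)
    (hγ1 : γ ≤ 1) (hR : 0 ≤ R) (h : 0 ≤ coneGap c.exponent ε γ R y z) :
    γ * ‖c.polar ε z - y‖ ≤ R := by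
  rw [← sq_le_sq₀ (by positivity) hR, mul_pow, EuclideanSpace.norm_sq_eq, Finset.mul_sum]
  refine le_trans (Finset.sum_le_sum fun j _ => ?_) (sub_nonneg.1 h)
  rw [PiLp.sub_apply, c.polar_apply, ← mul_pow]
  have := mul_norm_sub_le_coneDist (ξ := polarMap (c.exponent j) ε (z j)) (w := y j) hγ hγ1
  gcongr

theorem SlantCylinder.continuous_center (S : SlantCylinder n) : Continuous S.center := by
  unfold center
  fun_prop

theorem SlantCylinder.norm_center_sub (S : SlantCylinder n) (s t : ℝ) :
    ‖S.center s - S.center t‖ = |s - t| * (‖S.y₁ - S.y₀‖ / (S.T₁ - S.T₀)) := by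
  have h := sub_pos.2 S.T_lt
  have e : S.center s - S.center t = ((s - t) / (S.T₁ - S.T₀)) • (S.y₁ - S.y₀) := by
    simp only [center, add_sub_add_left_eq_sub, ← sub_smul]
    congr 1
    ring
  rw [e, norm_smul, Real.norm_eq_abs, abs_div, abs_of_pos h]
  ring

/-- The gap changes in time at most at the rate given by the speed of the center, since the cone
distance is a contraction in each variable. -/
theorem SlantCylinder.coneGap_center_ge (S : SlantCylinder n) {b : Fin n → ℝ} {ε γ R : ℝ}
    {z : Space n} (hγ : 0 ≤ γ) (hγ1 : γ ≤ 1) (hR : 0 ≤ R) {t₀ t : ℝ} (ht : t ≤ t₀)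
    (h : 0 ≤ coneGap b ε γ R (S.center t₀) z) :
    coneGap b ε γ R (S.center t₀) z -
        n * (2 * R * (‖S.y₁ - S.y₀‖ / (S.T₁ - S.T₀)) * (t₀ - t) +
          (‖S.y₁ - S.y₀‖ / (S.T₁ - S.T₀)) ^ 2 * (t₀ - t) ^ 2) ≤
      coneGap b ε γ R (S.center t) z := by
  set v := ‖S.y₁ - S.y₀‖ / (S.T₁ - S.T₀) with hv
  have hv0 : 0 ≤ v := div_nonneg (norm_nonneg _) (sub_pos.2 S.T_lt).le
  have hd : ∀ j, coneDist γ (polarMap (b j) ε (z j)) (S.center t j) ^ 2 ≤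
      coneDist γ (polarMap (b j) ε (z j)) (S.center t₀ j) ^ 2 +
        (2 * R * v * (t₀ - t) + v ^ 2 * (t₀ - t) ^ 2) := fun j => by
    have h1 := abs_coneDist_sub_le hγ hγ1 (polarMap (b j) ε (z j)) (S.center t j) (S.center t₀ j)
    have h2 : ‖S.center t j - S.center t₀ j‖ ≤ v * (t₀ - t) := by
      refine (PiLp.norm_apply_le (S.center t - S.center t₀) j).trans ?_
      rw [S.norm_center_sub, abs_sub_comm, abs_of_nonneg (sub_nonneg.2 ht), mul_comm]
    have h3 : coneDist γ (polarMap (b j) ε (z j)) (S.center t₀ j) ≤ R := by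
      rw [← sq_le_sq₀ coneDist_nonneg hR]
      exact (Finset.single_le_sum
        (f := fun j => coneDist γ (polarMap (b j) ε (z j)) (S.center t₀ j) ^ 2)
        (fun _ _ => sq_nonneg _) (Finset.mem_univ j)).trans (sub_nonneg.1 h)
    have h4 := (abs_le.1 (h1.trans h2)).2
    have h5 : 0 ≤ v * (t₀ - t) := mul_nonneg hv0 (sub_nonneg.2 ht)
    have h6 := coneDist_nonneg (γ := γ) (ξ := polarMap (b j) ε (z j)) (w := S.center t j)
    nlinarith [mul_le_mul_of_nonneg_right h3 h5]
  have hs := Finset.sum_le_sum fun j (_ : j ∈ Finset.univ) => hd j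
  rw [Finset.sum_add_distrib, Finset.sum_const, Finset.card_univ, Fintype.card_fin,
    nsmul_eq_mul] at hs
  simp only [coneGap]
  linarith

theorem SlantCylinder.mem_closedDomain (S : SlantCylinder n) (c : ConeData n) {ε γ : ℝ}
    {z : Space n} {t : ℝ} (hγ : 0 < γ) (hγ1 : γ ≤ 1) (hz : z ∉ c.divisor)
    (ht : t ∈ Set.Icc S.T₀ S.T₁)
    (h : 0 ≤ coneGap c.exponent ε γ (γ * S.r / 2) (S.center t) z) :
    (z, t) ∈ S.closedDomain c ε := by
  refine ⟨⟨hz, ?_⟩, ht⟩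
  have hr := S.r_pos
  have h1 := c.mul_norm_polar_sub_le hγ.le hγ1 (by positivity) h
  have h2 : ‖c.polar ε z - S.center t‖ ≤ S.r / 2 := by
    rw [mul_div_assoc] at h1
    exact le_of_mul_le_mul_left h1 hγ
  linarith

/-- The slices are bounded in the holomorphic coordinates as well, because the polar coordinates
are proper. -/
theorem SlantCylinder.exists_bound (S : SlantCylinder n) (c : ConeData n) {ε : ℝ} :
    ∃ Z : ℝ, 0 < Z ∧ ∀ X ∈ S.closedDomain c ε, (∀ j, X.1 j ≠ 0) → ∀ j, ‖X.1 j‖ ≤ Z := by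
  set s := S.r + (‖S.y₀‖ + ‖S.y₁ - S.y₀‖)
  choose Z hZ0 hZ using fun j => exists_bound_of_polarRadius_le (ε := ε) (c.exponent_pos j)
    (c.exponent_le_one j) s
  refine ⟨1 + ∑ j, Z j, ?_, fun X hX hz j => ?_⟩
  · have := Finset.sum_nonneg fun j (_ : j ∈ Finset.univ) => (hZ0 j).le
    linarith
  · have h1 : ‖c.polar ε X.1‖ ≤ s := by
      have h2 := hX.1.2
      have h3 : ‖S.center X.2‖ ≤ ‖S.y₀‖ + ‖S.y₁ - S.y₀‖ := by
        refine (norm_add_le _ _).trans ?_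
        gcongr
        rw [norm_smul]
        refine mul_le_of_le_one_left (norm_nonneg _) ?_
        have h4 := sub_pos.2 S.T_lt
        rw [Real.norm_of_nonneg (div_nonneg (sub_nonneg.2 hX.2.1) h4.le), div_le_one h4]
        linarith [hX.2.2]
      have h5 := norm_le_norm_add_norm_sub' (c.polar ε X.1) (S.center X.2)
      simp only [s]
      linarith
    have h2 : polarRadius (c.exponent j) ε ‖X.1 j‖ ≤ s := by
      rw [← norm_polarMap (c.exponent_pos j) (hz j), ← c.polar_apply]
      exact (PiLp.norm_apply_le _ j).trans h1
    have h3 := hZ j _ (norm_nonneg _) h2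
    have h4 := Finset.single_le_sum (f := Z) (fun i _ => (hZ0 i).le) (Finset.mem_univ j)
    linarith

theorem continuousOn_of_isLocallyParabolicHolder {F : Type*} [NormedAddCommGroup F] {α : ℝ}
    (hα : 0 < α) {Q : Set (Space n × ℝ)} {f : Space n × ℝ → F}
    (h : IsLocallyParabolicHolder α Q f) : ContinuousOn f Q := by
  intro X hX
  obtain ⟨C, U, hU, hC⟩ := h X hX
  have h1 : Filter.Tendsto
      (fun Y : Space n × ℝ => C * (‖Y.1 - X.1‖ + Real.sqrt |Y.2 - X.2|) ^ α) (𝓝[Q] X) (𝓝 0) := by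
    have h2 : Continuous fun Y : Space n × ℝ =>
        C * (‖Y.1 - X.1‖ + Real.sqrt |Y.2 - X.2|) ^ α :=
      continuous_const.mul (Continuous.rpow_const (by fun_prop) fun _ => Or.inr hα.le)
    have h3 := h2.tendsto X
    simp only [sub_self, norm_zero, abs_zero, Real.sqrt_zero, add_zero, Real.zero_rpow hα.ne',
      mul_zero] at h3
    exact h3.mono_left nhdsWithin_le_nhds
  rw [ContinuousWithinAt, tendsto_iff_norm_sub_tendsto_zero]
  refine squeeze_zero' (Filter.Eventually.of_forall fun _ => norm_nonneg _) ?_ h1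
  filter_upwards [mem_nhdsWithin_of_mem_nhds hU, self_mem_nhdsWithin] with Y hY1 hY2
  exact hC Y ⟨hY1, hY2⟩ X ⟨mem_of_mem_nhds hU, hX⟩

theorem deriv_nonneg_of_eventually_le_left {q : ℝ → ℝ} {q' T t : ℝ} (hT : T < t)
    (hq : HasDerivWithinAt q q' (Set.Icc T t) t) (h : ∀ᶠ s in 𝓝[<] t, q s ≤ q t) : 0 ≤ q' := by
  have h1 : HasDerivWithinAt q q' (Set.Iio t) t :=
    (hq.mono_of_mem_nhdsWithin (Icc_mem_nhdsLE hT)).Iio_of_Iic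
  have h2 := hasDerivWithinAt_iff_tendsto_slope' (by simp) |>.1 h1
  refine ge_of_tendsto h2 ?_
  filter_upwards [h, self_mem_nhdsWithin] with s hs1 hs2
  rw [slope_def_field]
  exact div_nonneg_of_nonpos (by linarith) (sub_neg.2 hs2).le

end Gap

/-! ### The maximum principle -/

section MaximumPrinciple

variable {n : ℕ}

theorem exists_pos_le_forall_le {x : ℝ} (hx : 0 < x) {f : Fin n → ℝ} (hf : ∀ j, 0 < f j) :
    ∃ e : ℝ, 0 < e ∧ e ≤ x ∧ ∀ j, e ≤ f j := by
  have h1 : ∀ x : ℝ, 0 < x → ∀ᶠ e in 𝓝[>] (0 : ℝ), e ≤ x := fun x hx =>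
    Filter.Eventually.mono (mem_nhdsWithin_of_mem_nhds (gt_mem_nhds hx)) fun y hy => le_of_lt hy
  obtain ⟨e, h2, h3⟩ := (((h1 x hx).and
    (Filter.eventually_all.2 fun j => h1 _ (hf j))).and self_mem_nhdsWithin).exists
  exact ⟨e, h3, h2⟩

/-- The barrier estimate on the part of `{gap ≥ 0}` where no coordinate vanishes. The quadratic
inequality `hA` makes the barrier `exp (-A (t - T₀)) gap² / R⁴` a subsolution. -/
theorem le_barrier {c : ConeData n} {ε K γ A M : ℝ} {S : SlantCylinder n}
    {g : Space n × ℝ → Matrix (Fin n) (Fin n) ℂ} {u : Space n × ℝ → ℝ}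
    (hg : IsConicFamily c ε S K g) (hu : IsWeakSubsolution c ε S g u)
    (hK : 0 < K) (hγ : 0 < γ) (hγ1 : γ ≤ 1 / 2) (hγc : ∀ j, γ ≤ c.exponent j)
    (hA0 : 0 ≤ A)
    (hA : ∀ ρ : ℝ, 0 ≤ ρ → 0 ≤ A * ρ ^ 2 -
      (4 * n * (γ * S.r / 2) * (‖S.y₁ - S.y₀‖ / (S.T₁ - S.T₀)) + 8 * γ ^ 2 / K +
        2 * (n * K * (2 + 2 / γ))) * ρ + 8 * γ ^ 2 / K * (γ * S.r / 2) ^ 2)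
    (hM0 : 0 ≤ M) (hM : ∀ X ∈ S.closedDomain c ε, u X ≤ M)
    (hinit : ∀ z ∈ S.slice c ε S.T₀, u (z, S.T₀) ≤ 0)
    {z : Space n} {t : ℝ} (hz : ∀ j, z j ≠ 0) (ht : t ∈ Set.Icc S.T₀ S.T₁)
    (hgap : 0 ≤ coneGap c.exponent ε γ (γ * S.r / 2) (S.center t) z) :
    u (z, t) ≤ M * (1 - Real.exp (-(A * (t - S.T₀))) / (γ * S.r / 2) ^ 4 *
      coneGap c.exponent ε γ (γ * S.r / 2) (S.center t) z ^ 2) := by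
  have hr := S.r_pos
  have hγ' : γ ≤ 1 := by linarith
  set R := γ * S.r / 2 with hRdef
  have hR : 0 < R := by positivity
  set v := ‖S.y₁ - S.y₀‖ / (S.T₁ - S.T₀) with hv
  set gap : Space n × ℝ → ℝ := fun X => coneGap c.exponent ε γ R (S.center X.2) X.1 with hgapdef
  set E : ℝ → ℝ := fun s => Real.exp (-(A * (s - S.T₀))) / R ^ 4 with hE
  have hE0 : ∀ s, 0 < E s := fun s => by positivity
  have hEgap : ∀ X : Space n × ℝ, S.T₀ ≤ X.2 → 0 ≤ gap X → E X.2 * gap X ^ 2 ≤ 1 := by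
    intro X hX h0
    have h1 : gap X ^ 2 ≤ (R ^ 2) ^ 2 := by
      have : gap X ≤ R ^ 2 := coneGap_le
      gcongr
    have h2 : Real.exp (-(A * (X.2 - S.T₀))) ≤ 1 := by
      rw [Real.exp_le_one_iff, neg_nonpos]
      exact mul_nonneg hA0 (sub_nonneg.2 hX)
    have h3 : E X.2 ≤ 1 / R ^ 4 := by simp only [hE]; gcongr
    calc E X.2 * gap X ^ 2 ≤ 1 / R ^ 4 * (R ^ 2) ^ 2 := by gcongr
      _ = 1 := by field_simp
  obtain ⟨Z, hZ0, hZ⟩ := S.exists_bound c (ε := ε)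
  have hdom : ∀ X : Space n × ℝ, (∀ j, X.1 j ≠ 0) → X.2 ∈ Set.Icc S.T₀ S.T₁ → 0 ≤ gap X →
      X ∈ S.closedDomain c ε := fun X h1 h2 h3 =>
    S.mem_closedDomain c hγ hγ' (c.not_mem_divisor h1) h2 h3
  have hlogle : ∀ X : Space n × ℝ, (∀ j, X.1 j ≠ 0) → X ∈ S.closedDomain c ε →
      ∀ j, Real.log ‖X.1 j‖ ≤ Real.log Z := fun X h1 h2 j =>
    Real.log_le_log (norm_pos_iff.2 (h1 j)) (hZ X h2 h1 j)
  by_contra! hlt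
  set η := u (z, t) - M * (1 - E t * gap (z, t) ^ 2) with hη
  have hη0 : 0 < η := sub_pos.2 hlt
  have hQ0 : 0 ≤ ∑ j, (Real.log Z - Real.log ‖z j‖) + (t - S.T₀) :=
    add_nonneg (Finset.sum_nonneg fun j _ => sub_nonneg.2
      (hlogle (z, t) hz (hdom _ hz ht hgap) j)) (sub_nonneg.2 ht.1)
  set Q := ∑ j, (Real.log Z - Real.log ‖z j‖) + (t - S.T₀) with hQ
  set δ := η / (Q + 1) with hδ
  have hδ0 : 0 < δ := by positivity
  -- the comparison function: it tends to `-∞` at the coordinate hyperplanes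
  set W : Space n × ℝ → ℝ := fun X => u X - M * (1 - E X.2 * gap X ^ 2) -
    δ * (∑ j, (Real.log Z - Real.log ‖X.1 j‖) + (X.2 - S.T₀)) with hW
  have hWz : 0 < W (z, t) := by
    have : δ * Q < η := by
      rw [hδ, div_mul_eq_mul_div, div_lt_iff₀ (by positivity)]
      nlinarith
    simp only [hW]
    linarith
  obtain ⟨e, he0, heM, hez⟩ : ∃ e : ℝ, 0 < e ∧ e ≤ Z * Real.exp (-(M / δ)) ∧
      ∀ j, e ≤ ‖z j‖ :=
    exists_pos_le_forall_le (by positivity) fun j => norm_pos_iff.2 (hz j)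
  set C : Set (Space n × ℝ) :=
    {X | (∀ j, e ≤ ‖X.1 j‖) ∧ X.2 ∈ Set.Icc S.T₀ S.T₁} ∩ {X | 0 ≤ gap X} with hC
  have hCne : ∀ X ∈ C, ∀ j, X.1 j ≠ 0 := fun X hX j =>
    norm_pos_iff.1 (he0.trans_le (hX.1.1 j))
  have hCdom : ∀ X ∈ C, X ∈ S.closedDomain c ε := fun X hX => hdom X (hCne X hX) hX.1.2 hX.2
  have hgapc : ∀ X : Space n × ℝ, (∀ j, X.1 j ≠ 0) → ContinuousAt gap X := fun X hX =>
    c.continuousAt_coneGap hγ.le hγ' ε R (c.not_mem_divisor hX)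
      (S.continuous_center.comp continuous_snd).continuousAt continuousAt_fst
  have hCc : IsCompact C := by
    refine Metric.isCompact_of_isClosed_isBounded ?_ ?_
    · refine ContinuousOn.preimage_isClosed_of_isClosed (f := gap) (t := Set.Ici 0) ?_ ?_
        isClosed_Ici
      · exact fun X hX => (hgapc X fun j =>
          norm_pos_iff.1 (he0.trans_le (hX.1 j))).continuousWithinAt
      · refine IsClosed.inter ?_ (isClosed_Icc.preimage continuous_snd)
        have e1 : {X : Space n × ℝ | ∀ j, e ≤ ‖X.1 j‖} = ⋂ j, {X | e ≤ ‖X.1 j‖} := by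
          ext X
          simp
        have h1 : IsClosed {X : Space n × ℝ | ∀ j, e ≤ ‖X.1 j‖} := by
          rw [e1]
          exact isClosed_iInter fun j => isClosed_le continuous_const (by fun_prop)
        exact h1
    · refine (Metric.isBounded_closedBall (x := (0 : Space n)) (r := Real.sqrt (n * Z ^ 2))).prod
        (Metric.isBounded_Icc S.T₀ S.T₁) |>.subset fun X hX => ⟨?_, hX.1.2⟩
      rw [mem_closedBall_zero_iff]
      refine Real.le_sqrt_of_sq_le ?_
      rw [EuclideanSpace.norm_sq_eq]
      calc ∑ j, ‖X.1 j‖ ^ 2 ≤ ∑ _ : Fin n, Z ^ 2 := Finset.sum_le_sum fun j _ => by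
            have := hZ X (hCdom X hX) (hCne X hX) j
            gcongr
        _ = n * Z ^ 2 := by simp
  obtain ⟨α, hα, -, hreg⟩ := hu.regular
  have hWc : ContinuousOn W C := by
    have h1 : ContinuousOn u C :=
      (continuousOn_of_isLocallyParabolicHolder hα hreg.holder).mono hCdom
    have h2 : ContinuousOn gap C := fun X hX => (hgapc X (hCne X hX)).continuousWithinAt
    have h3 : ContinuousOn (fun X : Space n × ℝ => ∑ j, (Real.log Z - Real.log ‖X.1 j‖)) C := by
      refine continuousOn_finsetSum _ fun j _ => continuousOn_const.sub (ContinuousOn.log ?_ ?_)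
      · fun_prop
      · exact fun X hX => norm_ne_zero_iff.2 (hCne X hX j)
    have h4 : ContinuousOn (fun X : Space n × ℝ => E X.2) C := by
      simp only [hE]
      fun_prop
    exact (h1.sub (continuousOn_const.mul (continuousOn_const.sub (h4.mul (h2.pow 2))))).sub
      (continuousOn_const.mul (h3.add (by fun_prop)))
  obtain ⟨X₀, hX₀, hmax⟩ := hCc.exists_isMaxOn ⟨(z, t), ⟨hez, ht⟩, hgap⟩ hWc
  have hW0 : 0 < W X₀ := hWz.trans_le (hmax (show (z, t) ∈ C from ⟨⟨hez, ht⟩, hgap⟩))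
  obtain ⟨z₀, t₀⟩ := X₀
  have hz₀ := hCne _ hX₀
  have hX₀d := hCdom _ hX₀
  have ht₀ : t₀ ∈ Set.Icc S.T₀ S.T₁ := hX₀.1.2
  have hgap₀ : 0 ≤ gap (z₀, t₀) := hX₀.2
  have hlog₀ : ∀ j, 0 ≤ Real.log Z - Real.log ‖z₀ j‖ := fun j =>
    sub_nonneg.2 (hlogle _ hz₀ hX₀d j)
  have hδlog : 0 ≤ δ * (∑ j, (Real.log Z - Real.log ‖z₀ j‖) + (t₀ - S.T₀)) :=
    mul_nonneg hδ0.le (add_nonneg (Finset.sum_nonneg fun j _ => hlog₀ j) (sub_nonneg.2 ht₀.1))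
  have hEgap₀ := hEgap (z₀, t₀) ht₀.1 hgap₀
  -- the maximum is not on the boundary of the region
  have ht₀' : S.T₀ < t₀ := by
    refine lt_of_le_of_ne ht₀.1 fun h => ?_
    have h1 : u (z₀, t₀) ≤ 0 := by
      have := hX₀d.1
      simp only [← h] at this ⊢
      exact hinit z₀ this
    have h2 := mul_nonneg hM0 (sub_nonneg.2 hEgap₀)
    simp only [hW] at hW0
    linarith
  have hgap₀' : 0 < gap (z₀, t₀) := by
    refine lt_of_le_of_ne hgap₀ fun h => ?_
    have h1 := hM _ hX₀d
    simp only [hW, ← h] at hW0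
    linarith
  have hez₀ : ∀ j, e < ‖z₀ j‖ := by
    intro j
    refine lt_of_le_of_ne (hX₀.1.1 j) fun h => ?_
    have h1 : Real.log ‖z₀ j‖ ≤ Real.log Z - M / δ := by
      rw [← h]
      refine (Real.log_le_log he0 heM).trans_eq ?_
      rw [Real.log_mul hZ0.ne' (Real.exp_pos _).ne', Real.log_exp]
      ring
    have h2 : M / δ ≤ ∑ j, (Real.log Z - Real.log ‖z₀ j‖) :=
      le_trans (by linarith) (Finset.single_le_sum
        (f := fun j => Real.log Z - Real.log ‖z₀ j‖) (fun i _ => hlog₀ i) (Finset.mem_univ j))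
    have h3 : M ≤ δ * ∑ j, (Real.log Z - Real.log ‖z₀ j‖) := by
      rwa [div_le_iff₀' hδ0] at h2
    have h4 := hM _ hX₀d
    have h5 := mul_nonneg hδ0.le (sub_nonneg.2 ht₀.1)
    have h6 := mul_le_mul_of_nonneg_left hEgap₀ hM0
    simp only [hW] at hW0
    linarith
  have hNe : 0 ≤ M * E t₀ := mul_nonneg hM0 (hE0 t₀).le
  -- the second derivative test in space
  have hspace : laplacian (g (z₀, t₀)) (fun x => u (x, t₀)) z₀ ≤
      -(M * E t₀ * (8 * γ ^ 2 / K * (R ^ 2 - gap (z₀, t₀)) -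
        2 * gap (z₀, t₀) * (n * K * (2 + 2 / γ)))) := by
    have hlow := hg.lower _ hX₀d
    have hup := hg.upper _ hX₀d
    rw [c.modelMetric_eq] at hlow hup
    refine laplacian_le_of_isLocalMax c.exponent_pos c.exponent_le_one hγ hγ1 hγc hz₀ hK
      (hg.posDef _ hX₀d) hlow hup (hreg.space_diff _ hX₀d) (δ := δ) hNe hgap₀' ?_
    have h1 : ∀ᶠ x in 𝓝 z₀, (x, t₀) ∈ C := by
      have hmk : Filter.Tendsto (fun x : Space n => (x, t₀)) (𝓝 z₀) (𝓝 (z₀, t₀)) :=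
        (Continuous.prodMk_left t₀).tendsto z₀
      have h2 := hmk.eventually ((hgapc _ hz₀).eventually_const_lt hgap₀')
      have h3 : ∀ᶠ x : Space n in 𝓝 z₀, ∀ j, e < ‖x j‖ := by
        refine Filter.eventually_all.2 fun j => ?_
        have : Continuous fun x : Space n => ‖x j‖ := by fun_prop
        exact this.continuousAt.eventually_const_lt (hez₀ j)
      filter_upwards [h2, h3] with x hx1 hx2
      exact ⟨⟨fun j => (hx2 j).le, ht₀⟩, hx1.le⟩
    filter_upwards [h1] with x hx
    have h2 := hmax hx
    simp only [hW, hgapdef, Set.mem_ofPred_eq, Finset.sum_sub_distrib] at h2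
    linarith
  -- the first derivative test in time
  have htime : δ + M * E t₀ * (A * gap (z₀, t₀) ^ 2 - 4 * n * R * v * gap (z₀, t₀)) ≤
      timeDeriv S u (z₀, t₀) := by
    set P : ℝ → ℝ := fun s =>
      gap (z₀, t₀) - n * (2 * R * v * (t₀ - s) + v ^ 2 * (t₀ - s) ^ 2) with hP
    have hP0 : P t₀ = gap (z₀, t₀) := by simp [hP]
    have hPd : HasDerivAt P (2 * n * R * v) t₀ := by
      have h1 : HasDerivAt (fun s : ℝ => t₀ - s) (-1) t₀ := (hasDerivAt_id t₀).const_sub t₀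
      refine ((((h1.const_mul (2 * R * v)).fun_add ((h1.fun_pow 2).const_mul (v ^ 2))).const_mul
        (n : ℝ)).const_sub (gap (z₀, t₀))).congr_deriv ?_
      simp
      ring
    have hEd : HasDerivAt E (-A * E t₀) t₀ := by
      have h1 : HasDerivAt (fun s : ℝ => -(A * (s - S.T₀))) (-A) t₀ := by
        simpa using (((hasDerivAt_id t₀).sub_const S.T₀).const_mul A).fun_neg
      refine (h1.exp.div_const (R ^ 4)).congr_deriv ?_
      simp only [hE]
      ring
    have hud : HasDerivWithinAt (fun s => u (z₀, s)) (timeDeriv S u (z₀, t₀))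
        (Set.Icc S.T₀ t₀) t₀ :=
      ((hreg.time_diff _ hX₀d).hasDerivWithinAt).mono (Set.Icc_subset_Icc_right ht₀.2)
    have hq := (hud.fun_add ((hEd.fun_mul (hPd.fun_pow 2)).const_mul M).hasDerivWithinAt).fun_sub
      ((hasDerivAt_id t₀).const_mul δ).hasDerivWithinAt
    have h0 := deriv_nonneg_of_eventually_le_left ht₀' hq (by
      have h1 : ∀ᶠ s in 𝓝[<] t₀, 0 < P s :=
        (hPd.continuousAt.eventually_const_lt (by rwa [hP0])).filter_mono nhdsWithin_le_nhds
      have h2 : ∀ᶠ s in 𝓝[<] t₀, S.T₀ < s := mem_nhdsWithin_of_mem_nhds (lt_mem_nhds ht₀')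
      filter_upwards [h1, h2, self_mem_nhdsWithin] with s hs1 hs2 hs3
      have hs3' : s ≤ t₀ := le_of_lt hs3
      have h3 : P s ≤ gap (z₀, s) := S.coneGap_center_ge hγ.le hγ' hR.le hs3' hgap₀
      have h4 : (z₀, s) ∈ C := ⟨⟨hX₀.1.1, hs2.le, hs3'.trans ht₀.2⟩, hs1.le.trans h3⟩
      have h5 := hmax h4
      have h6 : M * (E s * P s ^ 2) ≤ M * (E s * gap (z₀, s) ^ 2) := by
        have := (hE0 s).le
        gcongr
      simp only [hW, Set.mem_ofPred_eq] at h5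
      simp only [hP0, id]
      linarith)
    rw [hP0] at h0
    simp only [Nat.cast_ofNat, Nat.add_one_sub_one, pow_one] at h0
    linarith
  have hsub := hu.subsolution _ hX₀d
  have h1 := mul_nonneg hNe (hA _ hgap₀)
  linarith

end MaximumPrinciple

end Conic

open Conic in
theorem mainTheorem4 (n : ℕ) (hn : 1 ≤ n) (c : Conic.ConeData n) (K L T τ : ℝ) :
    ∃ lam : ℝ, 0 < lam ∧ lam < 1 ∧
      ∀ ε : ℝ, 0 ≤ ε → ε ≤ 1 →
      ∀ S : Conic.SlantCylinder n,
        ‖S.slope‖ ≤ L → S.T₁ - S.T₀ ≤ T → (S.T₁ - S.T₀) / S.r ^ 2 ≤ τ →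
      ∀ (g : Conic.Space n × ℝ → Matrix (Fin n) (Fin n) ℂ) (u : Conic.Space n × ℝ → ℝ),
        Conic.IsConicFamily c ε S K g →
        Conic.IsWeakSubsolution c ε S g u →
        (∀ z ∈ S.slice c ε S.T₀, u (z, S.T₀) ≤ 0) →
      ∀ z : Conic.Space n, z ∉ c.divisor → c.polar ε z = S.y₁ →
        u (z, S.T₁) ≤ (1 - lam) * sSup ((fun X => max (u X) 0) '' S.domain c ε) := by
  obtain ⟨γ, hγ0, hγ1, hγc⟩ : ∃ γ : ℝ, 0 < γ ∧ γ ≤ 1 / 2 ∧ ∀ j, γ ≤ c.exponent j :=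
    exists_pos_le_forall_le (by norm_num) c.exponent_pos
  -- the coefficients of the quadratic inequality which makes the barrier a subsolution
  set p := 8 * γ ^ 2 / K with hp
  set q := 2 * n * L + p + 2 * (n * K * (2 + 2 / γ)) with hq
  -- `A (T₁ - T₀) = q² / (p γ²) * (T₁ - T₀) / r²`; the summand `1` keeps `lam` below `1`
  refine ⟨Real.exp (-(1 + |q ^ 2 / (p * γ ^ 2)| * |τ|)), Real.exp_pos _, ?_, ?_⟩
  · rw [Real.exp_lt_one_iff, neg_lt_zero]
    positivity
  intro ε _ _ S hL _ hτ g u hg hu hinit z hz hzy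
  have hr := S.r_pos
  have hT := sub_pos.2 S.T_lt
  have hγ' : γ ≤ 1 := by linarith
  set R := γ * S.r / 2 with hR
  have hR0 : 0 < R := by positivity
  have hT₁ : S.T₁ ∈ Set.Icc S.T₀ S.T₁ := Set.right_mem_Icc.2 S.T_lt.le
  have hy₁ : S.center S.T₁ = S.y₁ := by
    simp [SlantCylinder.center, div_self hT.ne']
  have hgapz : coneGap c.exponent ε γ R (S.center S.T₁) z = R ^ 2 := by
    simp [coneGap, ← c.polar_apply, hzy, hy₁]
  have hzdom : (z, S.T₁) ∈ S.closedDomain c ε :=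
    S.mem_closedDomain c hγ0 hγ' hz hT₁ (by rw [hgapz]; positivity)
  have hK : 0 < K := by
    have h1 := (hg.posDef _ hzdom).diag_pos (i := ⟨0, hn⟩)
    have h2 := (hg.upper _ hzdom).diag_nonneg (i := ⟨0, hn⟩)
    rw [c.modelMetric_eq] at h2
    simp only [Matrix.sub_apply, Matrix.smul_apply, Matrix.diagonal_apply_eq, smul_eq_mul] at h2
    have h3 := (Complex.pos_iff.1 h1).1
    have h4 := (Complex.nonneg_iff.1 h2).1
    rw [Complex.sub_re, ← Complex.ofReal_mul, Complex.ofReal_re] at h4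
    exact pos_of_mul_pos_left (by linarith) (sq_nonneg _)
  have hp0 : 0 < p := by positivity
  set M := sSup ((fun X => max (u X) 0) '' S.domain c ε) with hM
  have hM0 : 0 ≤ M := Real.sSup_nonneg fun x ⟨X, _, hx⟩ => by
    rw [← hx]; exact le_max_right _ _
  have hbdd : BddAbove ((fun X => max (u X) 0) '' S.domain c ε) := by
    obtain ⟨m, hm⟩ := hu.bounded
    refine ⟨max m 0, ?_⟩
    rintro _ ⟨X, hX, rfl⟩
    exact max_le_max_right 0 ((le_abs_self _).trans (hm X hX))
  have huM : ∀ X ∈ S.closedDomain c ε, u X ≤ M := by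
    rintro ⟨x, t⟩ hX
    rcases hX.2.1.eq_or_lt with h | h
    · obtain rfl : S.T₀ = t := h
      exact (hinit x hX.1).trans hM0
    · have h1 : (x, t) ∈ S.domain c ε := ⟨hX.1.1, hX.1.2, h, hX.2.2⟩
      exact (le_max_left _ _).trans (le_csSup hbdd ⟨_, h1, rfl⟩)
  set A := q ^ 2 / (4 * p * R ^ 2) with hA
  have hA0 : 0 ≤ A := by positivity
  -- `A` makes the discriminant vanish when `q` is the linear coefficient
  have hquad : ∀ ρ : ℝ, 0 ≤ ρ → 0 ≤ A * ρ ^ 2 -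
      (4 * n * R * (‖S.y₁ - S.y₀‖ / (S.T₁ - S.T₀)) + p + 2 * (n * K * (2 + 2 / γ))) * ρ +
        p * R ^ 2 := by
    intro ρ hρ
    have h1 : 4 * n * R * (‖S.y₁ - S.y₀‖ / (S.T₁ - S.T₀)) ≤ 2 * n * L := by
      have h2 : S.r * (‖S.y₁ - S.y₀‖ / (S.T₁ - S.T₀)) ≤ L := by
        refine le_trans (le_of_eq ?_) hL
        rw [SlantCylinder.slope, norm_smul, Real.norm_of_nonneg (by positivity)]
        ring
      have h3 : 0 ≤ S.r * (‖S.y₁ - S.y₀‖ / (S.T₁ - S.T₀)) := by positivity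
      calc 4 * n * R * (‖S.y₁ - S.y₀‖ / (S.T₁ - S.T₀))
          = 2 * n * (γ * (S.r * (‖S.y₁ - S.y₀‖ / (S.T₁ - S.T₀)))) := by rw [hR]; ring
        _ ≤ 2 * n * L := by
          gcongr
          nlinarith
    have h4 : A * ρ ^ 2 - q * ρ + p * R ^ 2 = (q * ρ - 2 * p * R ^ 2) ^ 2 / (4 * p * R ^ 2) := by
      rw [hA]
      field_simp
      ring
    have h5 : 0 ≤ (q * ρ - 2 * p * R ^ 2) ^ 2 / (4 * p * R ^ 2) := by positivity
    have h6 := mul_le_mul_of_nonneg_right h1 hρ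
    rw [← h4, hq] at h5
    linarith
  have key : u (z, S.T₁) ≤ M * (1 - Real.exp (-(A * (S.T₁ - S.T₀))) / R ^ 4 *
      coneGap c.exponent ε γ R (S.center S.T₁) z ^ 2) := by
    -- approximate `z` by points all of whose coordinates are nonzero
    set ζ : ℝ → Space n := fun s => WithLp.toLp 2 fun j => if z j = 0 then (s : ℂ) else z j with hζ
    have hζ0 : ζ 0 = z := by
      ext j
      by_cases h : z j = 0 <;> simp [hζ, h]
    have hζc : Filter.Tendsto ζ (𝓝[>] 0) (𝓝 z) := by
      have : Continuous ζ := by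
        refine (PiLp.continuous_toLp 2 _).comp (continuous_pi fun j => ?_)
        split_ifs <;> fun_prop
      have h := this.tendsto 0
      rw [hζ0] at h
      exact h.mono_left nhdsWithin_le_nhds
    obtain ⟨α, -, -, hreg⟩ := hu.regular
    have h1 : Filter.Tendsto (fun s => u (ζ s, S.T₁)) (𝓝[>] 0) (𝓝 (u (z, S.T₁))) :=
      (hreg.space_diff _ hzdom).continuousAt.tendsto.comp hζc
    have hc : ContinuousAt (fun x => coneGap c.exponent ε γ R (S.center S.T₁) x) z :=
      c.continuousAt_coneGap hγ0.le hγ' ε R hz continuousAt_const continuousAt_id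
    have h2 : Filter.Tendsto (fun s => coneGap c.exponent ε γ R (S.center S.T₁) (ζ s)) (𝓝[>] 0)
        (𝓝 (coneGap c.exponent ε γ R (S.center S.T₁) z)) := hc.tendsto.comp hζc
    refine le_of_tendsto_of_tendsto h1
      (((h2.pow 2).const_mul _).const_sub 1 |>.const_mul M) ?_
    have h3 := h2.eventually_const_lt (u := 0) (by rw [hgapz]; positivity)
    filter_upwards [h3, self_mem_nhdsWithin] with s hs1 hs2
    refine le_barrier hg hu hK hγ0 hγ1 hγc hA0 hquad hM0 huM hinit (fun j => ?_) hT₁ hs1.le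
    by_cases h : z j = 0
    · simpa [hζ, h] using (ne_of_gt hs2 : s ≠ 0)
    · simp [hζ, h]
  have hexp : Real.exp (-(1 + |q ^ 2 / (p * γ ^ 2)| * |τ|)) ≤
      Real.exp (-(A * (S.T₁ - S.T₀))) := by
    rw [Real.exp_le_exp, neg_le_neg_iff]
    have h1 : A * (S.T₁ - S.T₀) = q ^ 2 / (p * γ ^ 2) * ((S.T₁ - S.T₀) / S.r ^ 2) := by
      rw [hA, hR]
      field_simp
      ring
    have h2 : q ^ 2 / (p * γ ^ 2) * ((S.T₁ - S.T₀) / S.r ^ 2) ≤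
        |q ^ 2 / (p * γ ^ 2)| * |τ| := by
      gcongr
      · exact le_abs_self _
      · exact hτ.trans (le_abs_self _)
    linarith
  rw [hgapz, ← pow_mul, div_mul_cancel₀ _ (by positivity)] at key
  calc u (z, S.T₁) ≤ M * (1 - Real.exp (-(A * (S.T₁ - S.T₀)))) := key
    _ ≤ M * (1 - Real.exp (-(1 + |q ^ 2 / (p * γ ^ 2)| * |τ|))) := by gcongr
    _ = _ := mul_comm _ _

end
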